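/- Let $p$ be a prime, let $m,s\ge 1$ and $n\ge 1$ be integers, let $\alpha_0\in\mathbb F_{p^m}$ be nonzero, let $\alpha=\alpha_0^{p^s}$ and $\beta\in\mathbb F_{p^m}$, and assume that $x^n-\alpha_0$ is irreducible over $\mathbb F_{p^m}$. Let $R=\mathbb F_{p^m}+u\mathbb F_{p^m}$ with $u^2=0$, and let $N=np^s$. The symbol-pair distance of $x,y\in R^N$ is the number of $i\in\mathbb Z/N$ with $(x_i,x_{i+1})\neq(y_i,y_{i+1})$, and $d_{sp}(\mathcal D)$ is its minimum over distinct codewords of $\mathcal D\subseteq R^N$. A code $\mathcal D$ is an MDS symbol-pair code if $|\mathcal D|=|R|^{N-d_{sp}(\mathcal D)+2}$. A submodule $\mathcal D\subseteq R^N$ is $\lambda$-constacyclic if it equals its image under $(x_0,\dots,x_{N-1})\mapsto(\lambda x_{N-1},x_0,\dots,x_{N-2})$; such codes are identified with ideals of $R[x]/\langle x^N-\lambda\rangle$. A code is nontrivial if it is neither $0$ nor $R^N$. Then a code $\mathcal D\subseteq R^N$ is a nontrivial MDS symbol-pair $(\alpha+u\beta)$-constacyclic code if and only if $\beta=0$,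 $n\in\{1,2\}$, and, writing $f=x^n-\alpha_0$, one has $\mathcal D=\langle f^{\,j}+u f^{\,k}b(x)\rangle$ for some $b(x)$ that is either zero or a unit in $\mathbb F_{p^m}[x]/\langle x^N-\alpha\rangle$ and some $(n,s,j,k)$ occurring in the following table. Moreover, each code in the table has the listed size and symbol-pair distance. 1. $n=1$, $p^s\ge 3$, $j=1$, $k=0$: size $p^{2m(p^s-1)}$, distance $3$. 2. $n=1$, $s\ge 2$, $j=2$, $k\in\{0,1\}$: size $p^{2m(p^s-2)}$, distance $4$. 3. $n=1$, $p=3$, $s=2$, $j=4$, $0\le k\le 3$: size $p^{10m}$, distance $6$. 4. $n=1$, $s=1$, $1\le j\le p-2$, $\max\{0,2j-p\}\le k<j$: size $p^{2m(p-j)}$, distance $j+2$. 5. $n=1$, $j=p^s-2$, $k\in\{p^s-4,p^s-3\}$ with $k\ge 0$: size $p^{4m}$, distance $p^s$. 6. $n=2$, $j=1$, $k=0$: size $p^{4m(p^s-1)}$, distance $4$. 7. $n=2$, $s=1$, $1\le j\le p-2$, $\max\{0,2j-p\}\le k<j$: size $p^{4m(p-j)}$, distance $2j+2$. 8. $n=2$,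 $j=p^s-1$, $k=p^s-2$: size $p^{4m}$, distance $2p^s$. -/

import Mathlib

open Polynomial
open scoped DualNumber

namespace SymbolPair

/-- The symbol-pair vector `((x₀,x₁), (x₁,x₂), …, (x_{N-1},x₀))` of `x`; `finRotate N` is the
cyclic successor `i ↦ i + 1` on `Fin N`. -/
def pairVector {A : Type*} {N : ℕ} (x : Fin N → A) : Fin N → A × A :=
  fun i => (x i, x (finRotate N i))

open Classical in
/-- The symbol-pair distance of two words: the Hamming distance of their symbol-pair vectors. -/
noncomputable def pairDist {A : Type*} {N : ℕ} (x y : Fin N → A) : ℕ :=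
  hammingDist (pairVector x) (pairVector y)

/-- The minimum symbol-pair distance of a code (`0` if the code has at most one codeword). -/
noncomputable def minPairDist {A : Type*} {N : ℕ} (S : Set (Fin N → A)) : ℕ :=
  sInf {d | ∃ x ∈ S, ∃ y ∈ S, x ≠ y ∧ pairDist x y = d}

/-- An MDS symbol-pair code: equality in the Singleton bound `|S| ≤ q ^ (N - d + 2)`.
(As `d ≤ N`, the natural number `N + 2 - d` is not truncated.) -/
def IsMDS {A : Type*} {N : ℕ} (S : Set (Fin N → A)) : Prop :=
  Nat.card S = Nat.card A ^ (N + 2 - minPairDist S)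

/-- The `lam`-constacyclic shift
`(x₀, …, x_{N-1}) ↦ (lam * x_{N-1}, x₀, …, x_{N-2})`. -/
def constaShift {R : Type*} [CommRing R] {N : ℕ} (lam : R) (x : Fin N → R) : Fin N → R :=
  fun i => (if (i : ℕ) = 0 then lam else 1) * x ((finRotate N).symm i)

/-- A linear code is `lam`-constacyclic if its `lam`-constacyclic shift is the code itself. -/
def IsConstacyclic {R : Type*} [CommRing R] {N : ℕ} (lam : R) (D : Submodule R (Fin N → R)) :
    Prop :=
  constaShift lam '' (D : Set (Fin N → R)) = D

/-- The polynomial `c₀ + c₁ x + ⋯ + c_{N-1} x^{N-1}` of a word. -/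
noncomputable def wordPoly {R : Type*} [CommRing R] {N : ℕ} (c : Fin N → R) : R[X] :=
  ∑ i : Fin N, C (c i) * X ^ (i : ℕ)

/-- The code of length `N` identified with the ideal `⟨g⟩` of `R[x] / ⟨x ^ N - lam⟩`: the words
whose polynomial lies in that ideal. -/
noncomputable def polyCode {R : Type*} [CommRing R] (N : ℕ) (lam : R) (g : R[X]) :
    Submodule R (Fin N → R) where
  carrier := {c | AdjoinRoot.mk (X ^ N - C lam) (wordPoly c) ∈
    Ideal.span {AdjoinRoot.mk (X ^ N - C lam) g}}
  zero_mem' := by simp [wordPoly]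
  add_mem' := by
    intro a b ha hb
    have h : wordPoly (a + b) = wordPoly a + wordPoly b := by
      simp [wordPoly, add_mul, Finset.sum_add_distrib]
    simp only [Set.mem_ofPred_eq, h, map_add] at ha hb ⊢
    exact Ideal.add_mem _ ha hb
  smul_mem' := by
    intro r a ha
    have h : wordPoly (r • a) = C r * wordPoly a := by
      simp [wordPoly, mul_assoc, Finset.mul_sum]
    simp only [Set.mem_ofPred_eq, h, map_mul] at ha ⊢
    exact Ideal.mul_mem_left _ _ ha

/-- `b` represents either zero or a unit of `F[x] / ⟨x ^ N - α⟩`. -/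
def IsZeroOrUnit {F : Type*} [Field F] (N : ℕ) (α : F) (b : F[X]) : Prop :=
  AdjoinRoot.mk (X ^ N - C α) b = 0 ∨ IsUnit (AdjoinRoot.mk (X ^ N - C α) b)

/-- The code `⟨(x ^ n - α₀) ^ j + u (x ^ n - α₀) ^ k b(x)⟩` of length `n p ^ s` over `F + uF`, an
ideal of `(F + uF)[x] / ⟨x ^ (n p ^ s) - α₀ ^ (p ^ s)⟩`; here `F + uF` is `F[ε]` and `u = ε`. -/
noncomputable def tableCode {F : Type*} [Field F] (p n s : ℕ) (α₀ : F) (j k : ℕ) (b : F[X]) :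
    Submodule F[ε] (Fin (n * p ^ s) → F[ε]) :=
  polyCode (n * p ^ s) (algebraMap F F[ε] (α₀ ^ p ^ s))
    (((X ^ n - C α₀) ^ j).map (algebraMap F F[ε]) +
      C ε * ((X ^ n - C α₀) ^ k * b).map (algebraMap F F[ε]))

/-- The rows of the table of MDS codes. `TableRow p m n s j k size d` says that the codes
`⟨(x ^ n - α₀) ^ j + u (x ^ n - α₀) ^ k b(x)⟩` of length `n p ^ s` over `𝔽_{p^m} + u 𝔽_{p^m}`, with
`b(x)` zero or a unit, are listed, with `size` codewords and symbol-pair distance `d`. -/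
inductive TableRow (p m : ℕ) : (n s j k size d : ℕ) → Prop
  | row1 (s : ℕ) (h : 3 ≤ p ^ s) :
      TableRow p m 1 s 1 0 (p ^ (2 * m * (p ^ s - 1))) 3
  | row2 (s k : ℕ) (hs : 2 ≤ s) (hk : k = 0 ∨ k = 1) :
      TableRow p m 1 s 2 k (p ^ (2 * m * (p ^ s - 2))) 4
  | row3 (k : ℕ) (hp : p = 3) (hk : k ≤ 3) :
      TableRow p m 1 2 4 k (p ^ (10 * m)) 6
  | row4 (j k : ℕ) (hj : 1 ≤ j) (hjp : j + 2 ≤ p) (hk : 2 * j ≤ p + k) (hkj : k < j) :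
      TableRow p m 1 1 j k (p ^ (2 * m * (p - j))) (j + 2)
  | row5 (s k : ℕ) (hk : k + 4 = p ^ s ∨ k + 3 = p ^ s) :
      TableRow p m 1 s (p ^ s - 2) k (p ^ (4 * m)) (p ^ s)
  | row6 (s : ℕ) :
      TableRow p m 2 s 1 0 (p ^ (4 * m * (p ^ s - 1))) 4
  | row7 (j k : ℕ) (hj : 1 ≤ j) (hjp : j + 2 ≤ p) (hk : 2 * j ≤ p + k) (hkj : k < j) :
      TableRow p m 2 1 j k (p ^ (4 * m * (p - j))) (2 * j + 2)
  | row8 (s : ℕ) :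
      TableRow p m 2 s (p ^ s - 1) (p ^ s - 2) (p ^ (4 * m)) (2 * p ^ s)

end SymbolPair

/-! Write f = x^n - α₀ and q = |F|, so that f^(p^s) = x^N - α. A constacyclic code D corresponds to
an ideal I of (F + uF)[x] containing x^N - (α + uβ). The reductions of I modulo u, and the h with uh
∈ I, form two ideals of F[x] containing f^(p^s); as f is irreducible, they are generated by f^i and
f^j, with j ≤ i. Then |D| = q^(2N - n(i+j)) by `card_eq_mul`, and D has the pair distance d of the
code over F of the multiples of f^j (`minPairDist_eq_multipleCode`). The MDS equation becomes n(i+j)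
= 2(d-2). The word f^j gives d ≤ nj+2, so i = j and d = nj+2. Equality of the two ideals forces β =
0 and yields the single generator (`eq_zero_of_residueIdeal_eq_torsionIdeal`,
`exists_pow_mul_isZeroOrUnit`, `eq_span_pair`).

There remains a question over F: when is d = nj+2? Since f^(p^t) is a binomial, f^j has sparse
multiples; their pair weights exclude everything outside the table
(`length_le_two_of_minPairDist_eq`, `exists_tableRow_one`, `exists_tableRow_two`). Conversely
`TableRow.le_pairWeight` proves the bound row by row. For s = 1, a derivative argument shows that a
nonzero multiple of (x - a)^j of degree below p has more than j terms, and n = 2 reduces to this by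
splitting exponents by parity. The remaining rows follow from root counting or from rotating zeros
into a convenient place, with a finite check for length nine. -/

namespace SymbolPair

/-! ### Words as polynomials, constacyclic codes as ideals -/

section Words

variable {R : Type*} [CommRing R] {N : ℕ}

theorem coeff_wordPoly (c : Fin N → R) (k : ℕ) :
    (wordPoly c).coeff k = if h : k < N then c ⟨k, h⟩ else 0 := by
  simp only [wordPoly, finsetSum_coeff, coeff_C_mul, coeff_X_pow, mul_ite, mul_one, mul_zero]
  split_ifs with h
  · rw [Finset.sum_eq_single ⟨k, h⟩]
    · simp
    · intro i _ hi
      rw [if_neg]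
      rintro rfl
      exact hi rfl
    · simp
  · refine Finset.sum_eq_zero fun i _ => if_neg ?_
    have := i.2
    omega

@[simp]
theorem coeff_wordPoly_val (c : Fin N → R) (i : Fin N) : (wordPoly c).coeff i = c i := by
  simp [coeff_wordPoly]

theorem coeff_wordPoly_of_le (c : Fin N → R) {k : ℕ} (h : N ≤ k) : (wordPoly c).coeff k = 0 := by
  simp [coeff_wordPoly, h]

theorem degree_wordPoly_lt (c : Fin N → R) : (wordPoly c).degree < N :=
  (degree_lt_iff_coeff_zero _ _).2 fun _ h => coeff_wordPoly_of_le c h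

theorem wordPoly_injective : Function.Injective (wordPoly : (Fin N → R) → R[X]) := by
  intro c d h
  ext i
  rw [← coeff_wordPoly_val c, h, coeff_wordPoly_val]

/-- The word of the first `N` coefficients of a polynomial. -/
def polyWord (N : ℕ) (g : R[X]) : Fin N → R := fun i => g.coeff i

theorem wordPoly_polyWord {g : R[X]} (hg : g.degree < N) : wordPoly (polyWord N g) = g := by
  ext k
  rw [coeff_wordPoly]
  split_ifs with h
  · rfl
  · exact (coeff_eq_zero_of_degree_lt (hg.trans_le (by exact_mod_cast not_lt.1 h))).symm

@[simp]
theorem wordPoly_zero : wordPoly (0 : Fin N → R) = 0 := by simp [wordPoly]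

theorem wordPoly_add (a b : Fin N → R) : wordPoly (a + b) = wordPoly a + wordPoly b := by
  ext k
  simp only [coeff_add, coeff_wordPoly]
  split_ifs <;> simp

theorem wordPoly_smul (r : R) (a : Fin N → R) : wordPoly (r • a) = C r * wordPoly a := by
  ext k
  simp only [coeff_C_mul, coeff_wordPoly]
  split_ifs <;> simp

theorem wordPoly_eq_zero {c : Fin N → R} : wordPoly c = 0 ↔ c = 0 :=
  ⟨fun h => wordPoly_injective (h.trans wordPoly_zero.symm), fun h => by rw [h, wordPoly_zero]⟩

theorem val_finRotate (i : Fin N) : (finRotate N i : ℕ) = (i + 1) % N := by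
  obtain _ | N := N
  · exact i.elim0
  · rw [finRotate_apply, Fin.val_add, Fin.val_one']
    simp

theorem constaShift_finRotate (lam : R) (c : Fin N → R) (i : Fin N) :
    constaShift lam c (finRotate N i) =
      (if (i + 1 : ℕ) % N = 0 then lam else 1) * c i := by
  rw [constaShift, val_finRotate, Equiv.symm_apply_apply]

/-- The leading coefficient wraps around to degree 0 and picks up `lam`, so the shift is
multiplication by `X` modulo `X ^ N - lam`. -/
theorem X_mul_wordPoly (lam : R) (hN : 0 < N) (c : Fin N → R) :
    X * wordPoly c = wordPoly (constaShift lam c) +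
      C (c ⟨N - 1, by omega⟩) * (X ^ N - C lam) := by
  have key : ∀ i : Fin N, constaShift lam c (finRotate N i) =
    (if (i + 1 : ℕ) % N = 0 then lam else 1) * c i := constaShift_finRotate lam c
  ext k
  simp only [coeff_add, coeff_C_mul, coeff_sub, coeff_X_pow, coeff_C]
  obtain _ | k := k
  · have h0 : finRotate N ⟨N - 1, by omega⟩ = ⟨0, hN⟩ := by
      ext
      rw [val_finRotate]
      simp [Nat.sub_add_cancel hN]
    have := key ⟨N - 1, by omega⟩
    rw [h0] at this
    simp only [Nat.sub_add_cancel hN, Nat.mod_self, if_true] at this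
    simp [coeff_wordPoly, hN, this, hN.ne, mul_comm]
  · rw [coeff_X_mul, coeff_wordPoly, coeff_wordPoly]
    rcases lt_trichotomy (k + 1) N with h | h | h
    · have h0 : finRotate N ⟨k, by omega⟩ = ⟨k + 1, h⟩ := by
        ext
        rw [val_finRotate]
        simp [Nat.mod_eq_of_lt h]
      have := key ⟨k, by omega⟩
      rw [h0] at this
      simp only [Nat.mod_eq_of_lt h] at this
      simp [h, this, h.ne, show k < N by omega]
    · subst h
      simp
    · simp [show ¬ k < N by omega, show ¬ k + 1 < N by omega, show ¬ k + 1 = N by omega]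

/-- A shift-invariant submodule of words is cut out by an ideal containing `X ^ N - lam`. -/
theorem exists_ideal_of_constaShift_mem [Nontrivial R] {lam : R} (hN : 0 < N)
    (D : Submodule R (Fin N → R)) (hD : ∀ c ∈ D, constaShift lam c ∈ D) :
    ∃ I : Ideal R[X], X ^ N - C lam ∈ I ∧ ∀ c, c ∈ D ↔ wordPoly c ∈ I := by
  have hX : ∀ g : R[X], (∃ c ∈ D, ∃ h, g = wordPoly c + h * (X ^ N - C lam)) →
      ∃ c ∈ D, ∃ h, X * g = wordPoly c + h * (X ^ N - C lam) := by
    rintro _ ⟨c, hc, h, rfl⟩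
    refine ⟨_, hD c hc, C (c ⟨N - 1, by omega⟩) + X * h, ?_⟩
    rw [mul_add, X_mul_wordPoly lam hN]
    ring
  have hadd : ∀ g g' : R[X], (∃ c ∈ D, ∃ h, g = wordPoly c + h * (X ^ N - C lam)) →
      (∃ c ∈ D, ∃ h, g' = wordPoly c + h * (X ^ N - C lam)) →
      ∃ c ∈ D, ∃ h, g + g' = wordPoly c + h * (X ^ N - C lam) := by
    rintro _ _ ⟨c, hc, h, rfl⟩ ⟨c', hc', h', rfl⟩
    refine ⟨_, D.add_mem hc hc', h + h', ?_⟩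
    rw [wordPoly_add]
    ring
  have hC : ∀ (r : R) (g : R[X]), (∃ c ∈ D, ∃ h, g = wordPoly c + h * (X ^ N - C lam)) →
      ∃ c ∈ D, ∃ h, C r * g = wordPoly c + h * (X ^ N - C lam) := by
    rintro r _ ⟨c, hc, h, rfl⟩
    refine ⟨_, D.smul_mem r hc, C r * h, ?_⟩
    rw [wordPoly_smul]
    ring
  refine ⟨{ carrier := {g | ∃ c ∈ D, ∃ h, g = wordPoly c + h * (X ^ N - C lam)}
            zero_mem' := ⟨0, D.zero_mem, 0, by simp⟩
            add_mem' := fun {g g'} hg hg' => hadd g g' hg hg'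
            smul_mem' := fun r g hg => ?_ }, ?_, fun c => ⟨fun hc => ?_, ?_⟩⟩
  · rw [smul_eq_mul]
    induction r using Polynomial.induction_on' with
    | add r r' h h' => rw [add_mul]; exact hadd _ _ h h'
    | monomial n a =>
      rw [← C_mul_X_pow_eq_monomial, mul_assoc]
      refine hC a _ ?_
      induction n with
      | zero => simpa using hg
      | succ n ih => rw [pow_succ', mul_assoc]; exact hX _ ih
  · exact ⟨0, D.zero_mem, 1, by simp⟩
  · exact ⟨c, hc, 0, by simp⟩
  · rintro ⟨c', hc', h, hh⟩
    have hM : (X ^ N - C lam : R[X]).Monic := monic_X_pow_sub_C lam hN.ne'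
    have hdeg : (X ^ N - C lam : R[X]).degree = N := degree_X_pow_sub_C hN lam
    -- Both words have degree below `N`, so uniqueness of division with remainder makes the quotient
    -- `h` vanish.
    have h1 : h = 0 := by
      refine ((div_modByMonic_unique (f := wordPoly c) h (wordPoly c') hM ⟨?_, ?_⟩).1).symm.trans ?_
      · rw [hh]; ring
      · rw [hdeg]; exact degree_wordPoly_lt _
      · rw [divByMonic_eq_zero_iff hM, hdeg]; exact degree_wordPoly_lt _
    rw [h1, zero_mul, add_zero] at hh
    rwa [wordPoly_injective hh]

theorem constaShift_mem_of_ideal {lam : R} (hN : 0 < N) {I : Ideal R[X]}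
    (hI : X ^ N - C lam ∈ I) {c : Fin N → R} (hc : wordPoly c ∈ I) :
    wordPoly (constaShift lam c) ∈ I := by
  have h := X_mul_wordPoly lam hN c
  rw [eq_sub_of_add_eq h.symm]
  exact I.sub_mem (I.mul_mem_left _ hc) (I.mul_mem_left _ hI)

theorem constaShift_injective {lam : R} (hlam : IsUnit lam) :
    Function.Injective (constaShift (N := N) lam) := by
  intro c d h
  ext i
  have := congrFun h (finRotate N i)
  rw [constaShift_finRotate, constaShift_finRotate] at this
  refine IsUnit.mul_left_cancel ?_ this
  split_ifs
  exacts [hlam, isUnit_one]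

/-- For a unit `lam` the shift is injective, so on a finite code inclusion of the image already
gives equality. -/
theorem isConstacyclic_iff [Finite R] {lam : R} (hlam : IsUnit lam)
    (D : Submodule R (Fin N → R)) :
    IsConstacyclic lam D ↔ ∀ c ∈ D, constaShift lam c ∈ D := by
  refine ⟨fun h c hc => ?_, fun h => ?_⟩
  · have : constaShift lam c ∈ constaShift lam '' (D : Set (Fin N → R)) := ⟨c, hc, rfl⟩
    rw [h] at this
    exact this
  · refine Set.eq_of_subset_of_ncard_le ?_ ?_ (Set.toFinite _)
    · rintro _ ⟨c, hc, rfl⟩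
      exact h c hc
    · rw [Set.ncard_image_of_injective _ (constaShift_injective hlam)]

theorem mem_polyCode (lam : R) (g : R[X]) (c : Fin N → R) :
    c ∈ polyCode N lam g ↔ wordPoly c ∈ Ideal.span {g, X ^ N - C lam} := by
  change AdjoinRoot.mk (X ^ N - C lam) (wordPoly c) ∈
    Ideal.span {AdjoinRoot.mk (X ^ N - C lam) g} ↔ _
  rw [Ideal.mem_span_singleton', Ideal.mem_span_pair]
  constructor
  · rintro ⟨a, ha⟩
    obtain ⟨a, rfl⟩ := AdjoinRoot.mk_surjective a
    rw [← map_mul, eq_comm, AdjoinRoot.mk_eq_mk] at ha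
    obtain ⟨b, hb⟩ := ha
    exact ⟨a, b, by rw [mul_comm b, ← hb]; ring⟩
  · rintro ⟨a, b, h⟩
    exact ⟨AdjoinRoot.mk _ a, by rw [← h]; simp⟩

end Words

/-! ### Symbol-pair weight and rotations -/

section PairWeight

variable {A : Type*} {N : ℕ}

open Classical in
/-- The positions at which the symbol-pair vector of a word is nonzero. -/
noncomputable def pairSupport [Zero A] (c : Fin N → A) : Finset (Fin N) :=
  {i | c i ≠ 0 ∨ c (finRotate N i) ≠ 0}

/-- The symbol-pair weight of a word. -/
noncomputable def pairWeight [Zero A] (c : Fin N → A) : ℕ := (pairSupport c).card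

@[simp]
theorem mem_pairSupport [Zero A] {c : Fin N → A} {i : Fin N} :
    i ∈ pairSupport c ↔ c i ≠ 0 ∨ c (finRotate N i) ≠ 0 := by
  simp [pairSupport]

theorem pairDist_eq_pairWeight [AddGroup A] (x y : Fin N → A) :
    pairDist x y = pairWeight (x - y) := by
  classical
  unfold pairDist pairWeight hammingDist
  congr 1
  ext i
  simp [pairVector, sub_eq_zero, Prod.ext_iff, imp_iff_not_or]

theorem pairWeight_le [Zero A] (c : Fin N → A) : pairWeight c ≤ N :=
  (Finset.card_le_univ _).trans_eq (Fintype.card_fin N)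

theorem pairWeight_mono {B : Type*} [Zero A] [Zero B] {c : Fin N → A} {d : Fin N → B}
    (h : ∀ i, d i = 0 → c i = 0) : pairWeight c ≤ pairWeight d := by
  refine Finset.card_le_card fun i => ?_
  simp only [mem_pairSupport]
  exact Or.imp (mt (h _)) (mt (h _))

theorem minPairDist_le {R : Type*} [Ring R] (D : Submodule R (Fin N → R)) {c : Fin N → R}
    (hc : c ∈ D) (h0 : c ≠ 0) : minPairDist (D : Set (Fin N → R)) ≤ pairWeight c :=
  Nat.sInf_le ⟨c, hc, 0, D.zero_mem, h0, by rw [pairDist_eq_pairWeight, sub_zero]⟩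

theorem exists_pairWeight_eq_minPairDist {R : Type*} [Ring R] (D : Submodule R (Fin N → R))
    (hD : D ≠ ⊥) : ∃ c ∈ D, c ≠ 0 ∧ pairWeight c = minPairDist (D : Set (Fin N → R)) := by
  obtain ⟨c, hc, h0⟩ := D.exists_mem_ne_zero_of_ne_bot hD
  have hne : {d | ∃ x ∈ (D : Set (Fin N → R)), ∃ y ∈ (D : Set (Fin N → R)),
      x ≠ y ∧ pairDist x y = d}.Nonempty := ⟨_, c, hc, 0, D.zero_mem, h0, rfl⟩
  obtain ⟨x, hx, y, hy, hxy, h⟩ := Nat.sInf_mem hne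
  exact ⟨x - y, D.sub_mem hx hy, sub_ne_zero.2 hxy, by rw [← pairDist_eq_pairWeight, h]; rfl⟩

theorem val_finRotate_pow (t : ℕ) (i : Fin N) :
    (((finRotate N ^ t : Equiv.Perm (Fin N)) i : Fin N) : ℕ) = (i + t) % N := by
  induction t with
  | zero => simp [Nat.mod_eq_of_lt i.2]
  | succ t ih =>
    rw [pow_succ', Equiv.Perm.mul_apply, val_finRotate, ih]
    simp [add_assoc]

theorem exists_finRotate_pow_eq (i l : Fin N) :
    ∃ t : ℕ, (finRotate N ^ t : Equiv.Perm (Fin N)) i = l := by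
  -- Adding `N` keeps the subtraction from being truncated when `l < i`.
  refine ⟨l + N - i, Fin.ext ?_⟩
  rw [val_finRotate_pow, show (i + (l + N - i) : ℕ) = l + N by omega, Nat.add_mod_right,
    Nat.mod_eq_of_lt l.2]

theorem iterate_constaShift_eq_zero_iff {R : Type*} [CommRing R] {lam : R} (hlam : IsUnit lam)
    (c : Fin N → R) (t : ℕ) (k : Fin N) :
    (constaShift lam)^[t] c ((finRotate N ^ t : Equiv.Perm (Fin N)) k) = 0 ↔ c k = 0 := by
  induction t with
  | zero => simp
  | succ t ih =>
    rw [Function.iterate_succ_apply', pow_succ', Equiv.Perm.mul_apply, constaShift_finRotate,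
      IsUnit.mul_right_eq_zero, ih]
    split_ifs
    exacts [hlam, isUnit_one]

/-- Rotating a word of a shift-invariant code moves any position to any other. -/
theorem exists_rotate {R : Type*} [CommRing R] {lam : R} (hlam : IsUnit lam)
    {D : Set (Fin N → R)} (hD : ∀ c ∈ D, constaShift lam c ∈ D) {c : Fin N → R} (hc : c ∈ D)
    (i l : Fin N) :
    ∃ c' ∈ D, pairWeight c' = pairWeight c ∧ ∃ e : Equiv.Perm (Fin N), e i = l ∧
      (∀ k, e (finRotate N k) = finRotate N (e k)) ∧ ∀ k, c' (e k) = 0 ↔ c k = 0 := by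
  obtain ⟨t, ht⟩ := exists_finRotate_pow_eq i l
  have hcomm : ∀ k, (finRotate N ^ t : Equiv.Perm (Fin N)) (finRotate N k) =
      finRotate N ((finRotate N ^ t : Equiv.Perm (Fin N)) k) := fun k => by
    rw [← Equiv.Perm.mul_apply, ← Equiv.Perm.mul_apply, pow_mul_comm']
  refine ⟨(constaShift lam)^[t] c, ?_, ?_, _, ht, hcomm,
    iterate_constaShift_eq_zero_iff hlam c t⟩
  · clear ht hcomm
    induction t with
    | zero => exact hc
    | succ t ih => rw [Function.iterate_succ_apply']; exact hD _ ih
  · refine (Finset.card_equiv (finRotate N ^ t : Equiv.Perm (Fin N)) fun k => ?_).symm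
    simp only [mem_pairSupport, ← hcomm, ne_eq, iterate_constaShift_eq_zero_iff hlam]

theorem exists_eq_zero_finRotate_ne_zero [Zero A] {c : Fin N → A} (hc : c ≠ 0)
    (h : ∃ i, c i = 0) : ∃ i, c i = 0 ∧ c (finRotate N i) ≠ 0 := by
  by_contra! hcon
  obtain ⟨i, hi⟩ := h
  refine hc (funext fun l => ?_)
  obtain ⟨t, rfl⟩ := exists_finRotate_pow_eq i l
  induction t with
  | zero => exact hi
  | succ t ih => rw [pow_succ', Equiv.Perm.mul_apply]; exact hcon _ ih

theorem pairWeight_eq_of_forall_ne_zero [Zero A] {c : Fin N → A}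
    (h : ∀ i, c i ≠ 0 ∨ c (finRotate N i) ≠ 0) : pairWeight c = N := by
  rw [pairWeight, Finset.eq_univ_iff_forall.2 fun i => mem_pairSupport.2 (h i), Finset.card_univ,
    Fintype.card_fin]

/-- Every nonzero position counts, and so does the zero just before some run of nonzero entries. -/
theorem lt_pairWeight [Zero A] {c : Fin N → A} (hc : c ≠ 0)
    (h : ∃ i, c i = 0) {w : ℕ} (s : Finset (Fin N)) (hs : ∀ i ∈ s, c i ≠ 0) (hw : w ≤ s.card) :
    w < pairWeight c := by
  obtain ⟨i, hi, hi'⟩ := exists_eq_zero_finRotate_ne_zero hc h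
  refine hw.trans_lt (Finset.card_lt_card ((Finset.ssubset_iff_of_subset fun k hk => ?_).2
    ⟨i, ?_, fun h => hs i h hi⟩))
  · exact mem_pairSupport.2 (Or.inl (hs k hk))
  · exact mem_pairSupport.2 (Or.inr hi')

/-- In even cyclic length, positions of one parity and their predecessors are disjoint, and all of
them lie in the pair support. -/
theorem two_mul_le_pairWeight [Zero A] (hN : 2 ∣ N) {c : Fin N → A} (r : ℕ)
    (s : Finset (Fin N)) (hs : ∀ i ∈ s, c i ≠ 0) (hr : ∀ i ∈ s, (i : ℕ) % 2 = r) :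
    2 * s.card ≤ pairWeight c := by
  classical
  have hdisj : Disjoint s (s.map (finRotate N).symm.toEmbedding) := by
    rw [Finset.disjoint_left]
    intro i hi hi'
    obtain ⟨k, hk, rfl⟩ := Finset.mem_map.1 hi'
    have h1 := hr _ hi
    have h2 := hr _ hk
    have h3 := val_finRotate ((finRotate N).symm k)
    rw [Equiv.apply_symm_apply] at h3
    simp only [Equiv.coe_toEmbedding] at h1
    rw [h3, Nat.mod_mod_of_dvd _ hN] at h2
    omega
  rw [two_mul]
  nth_rewrite 2 [← Finset.card_map (finRotate N).symm.toEmbedding]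
  rw [← Finset.card_union_of_disjoint hdisj]
  refine Finset.card_le_card fun i hi => mem_pairSupport.2 ?_
  rcases Finset.mem_union.1 hi with hi | hi
  · exact Or.inl (hs i hi)
  · obtain ⟨k, hk, rfl⟩ := Finset.mem_map.1 hi
    right
    rw [Equiv.coe_toEmbedding, Equiv.apply_symm_apply]
    exact hs k hk

/-- Each term of `a` carries a copy of `b` occupying at most `e + 1` consecutive places; its pair
support has at most one place more, just before it. -/
theorem pairWeight_polyWord_mul_le {R : Type*} [CommRing R] (a b : R[X]) {e : ℕ}
    (hb : b.natDegree ≤ e) : pairWeight (polyWord N (a * b)) ≤ a.support.card * (e + 2) := by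
  classical
  rw [← Finset.card_range (e + 2), ← Finset.card_product, pairWeight,
    ← Finset.card_map Fin.valEmbedding]
  refine (Finset.card_le_card fun i' hi' => ?_).trans
    -- The `- 1` is the shift to the predecessor; adding `N` first makes it cyclic at position 0.
    (Finset.card_image_le (f := fun x : ℕ × ℕ => (x.1 + x.2 + N - 1) % N))
  obtain ⟨i, hi, rfl⟩ := Finset.mem_map.1 hi'
  have key : ∀ k : ℕ, (a * b).coeff k ≠ 0 → ∃ u ∈ a.support, ∃ v ≤ e, u + v = k := by
    intro k hk
    rw [coeff_mul] at hk
    obtain ⟨x, hx, hx'⟩ := Finset.exists_ne_zero_of_sum_ne_zero hk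
    refine ⟨x.1, mem_support_iff.2 (left_ne_zero_of_mul hx'), x.2, ?_,
      Finset.HasAntidiagonal.mem_antidiagonal.1 hx⟩
    exact (le_natDegree_of_ne_zero (right_ne_zero_of_mul hx')).trans hb
  have hiN := i.2
  simp only [Finset.mem_image, Finset.mem_product, Finset.mem_range, Prod.exists,
    Fin.valEmbedding_apply]
  rcases mem_pairSupport.1 hi with h | h
  · obtain ⟨u, hu, v, hv, huv⟩ := key _ h
    refine ⟨u, v + 1, ⟨hu, by omega⟩, ?_⟩
    rw [show u + (v + 1) + N - 1 = i + N by omega, Nat.add_mod_right, Nat.mod_eq_of_lt hiN]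
  · obtain ⟨u, hu, v, hv, huv⟩ := key _ h
    refine ⟨u, v, ⟨hu, by omega⟩, ?_⟩
    rw [val_finRotate] at huv
    rw [huv]
    rcases (show (i + 1 : ℕ) ≤ N from hiN).eq_or_lt with h1 | h1
    · rw [h1, Nat.mod_self, Nat.mod_eq_of_lt (by omega)]
      omega
    · rw [Nat.mod_eq_of_lt h1, show (i + 1 + N - 1 : ℕ) = i + N by omega, Nat.add_mod_right,
        Nat.mod_eq_of_lt hiN]

end PairWeight

/-! ### Codes over the field: lower bounds for pair weights -/

section MultipleCode

variable {F : Type*} [Field F] {N : ℕ}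

/-- The code of the words whose polynomial is a multiple of `g`. -/
def multipleCode (N : ℕ) (g : F[X]) : Submodule F (Fin N → F) where
  carrier := {c | g ∣ wordPoly c}
  zero_mem' := by simp
  add_mem' := fun {a b} ha hb => by
    change g ∣ wordPoly (a + b)
    rw [wordPoly_add]
    exact dvd_add ha hb
  smul_mem' := fun r a ha => by
    change g ∣ wordPoly (r • a)
    rw [wordPoly_smul]
    exact Dvd.dvd.mul_left ha _

@[simp]
theorem mem_multipleCode {g : F[X]} {c : Fin N → F} : c ∈ multipleCode N g ↔ g ∣ wordPoly c :=
  Iff.rfl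

theorem constaShift_mem_multipleCode {g : F[X]} {α : F} (hN : 0 < N) (hg : g ∣ X ^ N - C α)
    {c : Fin N → F} (hc : c ∈ multipleCode N g) : constaShift α c ∈ multipleCode N g := by
  rw [mem_multipleCode, ← Ideal.mem_span_singleton] at hc ⊢
  exact constaShift_mem_of_ideal hN (Ideal.mem_span_singleton.2 hg) hc

theorem polyWord_mem_multipleCode {g h : F[X]} (hh : h.degree < N) (hgh : g ∣ h) :
    polyWord N h ∈ multipleCode N g := by
  rwa [mem_multipleCode, wordPoly_polyWord hh]

theorem polyWord_ne_zero {h : F[X]} (hh : h.degree < N) (h0 : h ≠ 0) : polyWord N h ≠ 0 := by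
  rwa [ne_eq, ← wordPoly_eq_zero, wordPoly_polyWord hh]

theorem card_multipleCode {g : F[X]} (hg : g.Monic) (hN : g.natDegree ≤ N) :
    Nat.card (multipleCode N g) = Nat.card F ^ (N - g.natDegree) := by
  have hcard : Nat.card (Fin (N - g.natDegree) → F) = Nat.card F ^ (N - g.natDegree) := by
    rw [Nat.card_fun, Nat.card_fin]
  rw [← hcard]
  have hdeg : ∀ d : Fin (N - g.natDegree) → F, (g * wordPoly d).degree < N := by
    intro d
    by_cases hd : wordPoly d = 0
    · rw [hd, mul_zero, degree_zero]; exact WithBot.bot_lt_coe _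
    · rw [degree_mul, degree_eq_natDegree hg.ne_zero, degree_eq_natDegree hd]
      have := degree_wordPoly_lt d
      rw [degree_eq_natDegree hd] at this
      norm_cast at this ⊢
      omega
  refine (Nat.card_congr (Equiv.ofBijective (fun d => (⟨polyWord N (g * wordPoly d),
    polyWord_mem_multipleCode (hdeg d) (dvd_mul_right _ _)⟩ : multipleCode N g)) ⟨?_, ?_⟩)).symm
  · intro d d' h
    have h1 := congrArg (fun c : multipleCode N g => wordPoly c.1) h
    simp only [wordPoly_polyWord (hdeg _)] at h1
    exact wordPoly_injective (mul_left_cancel₀ hg.ne_zero h1)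
  · rintro ⟨c, q, hq⟩
    have hqd : q.degree < (N - g.natDegree : ℕ) := by
      by_cases hq0 : q = 0
      · rw [hq0, degree_zero]; exact WithBot.bot_lt_coe _
      · have := degree_wordPoly_lt c
        rw [hq, degree_mul, degree_eq_natDegree hg.ne_zero, degree_eq_natDegree hq0] at this
        rw [degree_eq_natDegree hq0]
        norm_cast at this ⊢
        omega
    refine ⟨polyWord _ q, Subtype.ext (wordPoly_injective ?_)⟩
    simp only
    rw [wordPoly_polyWord (hdeg _), wordPoly_polyWord hqd, hq]

/-- A nonzero multiple of `g` cannot have degree below that of `g`. -/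
theorem eq_zero_of_mem_multipleCode {g : F[X]} {c : Fin N → F} (hc : c ∈ multipleCode N g)
    (h : ∀ i : Fin N, g.natDegree ≤ i → c i = 0) : c = 0 := by
  by_contra hne
  have h0 : wordPoly c ≠ 0 := wordPoly_eq_zero.not.2 hne
  have h1 := natDegree_le_of_dvd hc h0
  have h2 : (wordPoly c).natDegree < N :=
    (natDegree_lt_iff_degree_lt h0).2 (degree_wordPoly_lt c)
  have h3 := h ⟨_, h2⟩ h1
  rw [← coeff_wordPoly_val c] at h3
  exact h0 (leadingCoeff_eq_zero.1 h3)

theorem card_filter_ne_zero_eq_card_support [DecidableEq F] (c : Fin N → F) :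
    (Finset.univ.filter fun i => c i ≠ 0).card = (wordPoly c).support.card := by
  rw [← Finset.card_map Fin.valEmbedding]
  congr 1
  ext k
  simp only [Finset.mem_map, Finset.mem_filter, Finset.mem_univ, true_and, mem_support_iff,
    Fin.valEmbedding_apply, coeff_wordPoly]
  constructor
  · rintro ⟨i, hi, rfl⟩
    simpa using hi
  · intro h
    split_ifs at h with hk
    · exact ⟨⟨k, hk⟩, h, rfl⟩
    · exact absurd rfl h

theorem two_le_card_support {a : F} (ha : a ≠ 0) {g : F[X]} (hg : g ≠ 0) (h : X - C a ∣ g) :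
    2 ≤ g.support.card := by
  by_contra! hlt
  obtain ⟨k, b, rfl⟩ := card_support_le_one_iff_monomial.1 (Nat.lt_succ_iff.1 hlt)
  rw [dvd_iff_isRoot, IsRoot, eval_monomial, mul_eq_zero] at h
  rcases h with h | h
  · exact hg (by rw [h, map_zero])
  · exact ha (eq_zero_of_pow_eq_zero h)

/-- Induction on `j`: the operator X·d/dX - i multiplies the coefficient of X^l by l - i. It removes
the term X^i, keeps the others because exponents below `p` are distinct in `F`, and costs at most
one factor X - a. -/
theorem lt_card_support_of_pow_dvd (p : ℕ) [CharP F p] {a : F} (ha : a ≠ 0) (j : ℕ) {g : F[X]}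
    (hg : g ≠ 0) (hdeg : g.natDegree < p) (h : (X - C a) ^ j ∣ g) : j < g.support.card := by
  induction j generalizing g with
  | zero => exact Finset.card_pos.2 (nonempty_support_iff.2 hg)
  | succ j ih =>
    have h2 : 2 ≤ g.support.card :=
      two_le_card_support ha hg ((dvd_pow_self _ j.succ_ne_zero).trans h)
    obtain ⟨i, hi, k, hk, hik⟩ := Finset.one_lt_card.1 h2
    have hcoeff : ∀ l : ℕ, (X * derivative g - C (i : F) * g).coeff l =
        ((l : F) - i) * g.coeff l := by
      intro l
      obtain _ | l := l
      · simp
      · rw [coeff_sub, coeff_X_mul, coeff_derivative, coeff_C_mul]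
        push_cast
        ring
    have hlt : ∀ l ∈ g.support, l < p := fun l hl =>
      (le_natDegree_of_mem_supp l hl).trans_lt hdeg
    have hne : X * derivative g - C (i : F) * g ≠ 0 := by
      intro h0
      have := hcoeff k
      rw [h0, coeff_zero, eq_comm, mul_eq_zero, sub_eq_zero] at this
      rcases this with h | h
      · exact hik (CharP.natCast_injOn_Iio F p (hlt i hi) (hlt k hk) h.symm)
      · exact mem_support_iff.1 hk h
    have hsub : (X * derivative g - C (i : F) * g).support ⊆ g.support.erase i := by
      intro l hl
      rw [mem_support_iff, hcoeff] at hl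
      rw [Finset.mem_erase, mem_support_iff]
      refine ⟨?_, right_ne_zero_of_mul hl⟩
      rintro rfl
      simp at hl
    have hcard := Finset.card_le_card hsub
    rw [Finset.card_erase_of_mem hi] at hcard
    have := ih hne ?_ ?_
    · omega
    · rw [natDegree_lt_iff_degree_lt hne, degree_lt_iff_coeff_zero]
      intro l hl
      rw [hcoeff, coeff_eq_zero_of_natDegree_lt (hdeg.trans_le hl), mul_zero]
    · exact dvd_sub ((pow_sub_one_dvd_derivative_of_pow_dvd h).mul_left _)
        (((pow_dvd_pow _ j.le_succ).trans h).mul_left _)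

theorem add_two_le_pairWeight {j : ℕ} (hj : j + 2 ≤ N) {c : Fin N → F} (hc : c ≠ 0)
    (hW : j < (wordPoly c).support.card) : j + 2 ≤ pairWeight c := by
  classical
  by_cases h : ∃ i, c i = 0
  · refine lt_pairWeight hc h (Finset.univ.filter fun i => c i ≠ 0)
      (fun i hi => (Finset.mem_filter.1 hi).2) ?_
    rw [card_filter_ne_zero_eq_card_support]
    exact hW
  · push Not at h
    rwa [pairWeight_eq_of_forall_ne_zero fun i => Or.inl (h i)]

/-- If the multiples of `(X - a) ^ j` of degree `< M` have weight at least `j + 1`, then the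
multiples of `(X ^ 2 - a) ^ j` of degree `< 2 * M` have pair weight at least `2 * j + 2`. -/
theorem two_mul_add_two_le_pairWeight {M : ℕ} (hN : N = 2 * M) {a : F} (ha : a ≠ 0) {j : ℕ}
    (hW : ∀ G : F[X], G ≠ 0 → G.degree < M → (X - C a) ^ j ∣ G → j < G.support.card)
    {c : Fin N → F} (hc : c ≠ 0) (h : (X ^ 2 - C a) ^ j ∣ wordPoly c) :
    2 * j + 2 ≤ pairWeight c := by
  classical
  -- `G` collects the coefficients of one parity class; its more than `j` terms give as many nonzero
  -- positions of that parity, each counted twice.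
  have key : ∀ (r : ℕ) (G : F[X]), r < 2 → G ≠ 0 →
      (∀ t, G.coeff t = (wordPoly c).coeff (2 * t + r)) → (X - C a) ^ j ∣ G →
      2 * j + 2 ≤ pairWeight c := by
    intro r G hr hG hco hdvd
    have hlt : ∀ t ∈ G.support, 2 * t + r < N := by
      intro t ht
      by_contra! hle
      exact mem_support_iff.1 ht (by rw [hco, coeff_wordPoly_of_le c hle])
    have h1 : j < G.support.card := by
      refine hW G hG ((degree_lt_iff_coeff_zero _ _).2 fun t ht => ?_) hdvd
      rw [hco, coeff_wordPoly_of_le c (by omega)]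
    have h2 := two_mul_le_pairWeight (c := c) (Dvd.intro _ hN.symm) r
      (Finset.univ.filter fun i => c i ≠ 0 ∧ (i : ℕ) % 2 = r)
      (fun i hi => (Finset.mem_filter.1 hi).2.1) (fun i hi => (Finset.mem_filter.1 hi).2.2)
    have h3 : G.support.card ≤ (Finset.univ.filter fun i => c i ≠ 0 ∧ (i : ℕ) % 2 = r).card := by
      rw [← Finset.card_map (Fin.valEmbedding (n := N))]
      refine Finset.card_le_card_of_injOn (fun t => 2 * t + r) ?_ ?_
      · intro t ht
        simp only [Finset.coe_map, Set.mem_image, Finset.mem_coe, Finset.mem_filter,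
          Finset.mem_univ, true_and, Fin.valEmbedding_apply]
        refine ⟨⟨2 * t + r, hlt t ht⟩, ⟨?_, by simp only; omega⟩, rfl⟩
        rw [← coeff_wordPoly_val c, ← hco]
        exact mem_support_iff.1 ht
      · intro t _ t' _ htt
        simp only at htt
        omega
    omega
  have hcop : IsCoprime ((X - C a : F[X]) ^ j) X := by
    refine IsCoprime.pow_left ((irreducible_X_sub_C a).coprime_iff_not_dvd.2 ?_)
    rw [dvd_iff_isRoot]
    simpa using ha
  -- Contraction is linear over expanded polynomials, so this factor passes to each parity class; in
  -- the odd class the extra factor `X` is removed by coprimality.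
  have hexp : (expand F 2 ((X - C a) ^ j)) = (X ^ 2 - C a) ^ j := by simp
  by_cases h0 : contract 2 (wordPoly c) = 0
  · have h1 : contract 2 (divX (wordPoly c)) ≠ 0 := by
      intro h1
      refine wordPoly_eq_zero.not.2 hc (Polynomial.ext fun k => ?_)
      obtain ⟨t, rfl | rfl⟩ : ∃ t, k = t * 2 ∨ k = t * 2 + 1 := ⟨k / 2, by omega⟩
      · rw [← coeff_contract two_ne_zero, h0, coeff_zero, coeff_zero]
      · rw [← coeff_divX, ← coeff_contract two_ne_zero, h1, coeff_zero, coeff_zero]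
    refine key 1 _ (by omega) h1 (fun t => ?_) ?_
    · rw [coeff_contract two_ne_zero, coeff_divX, mul_comm]
    · have h2 : contract 2 (X * wordPoly c) = X * contract 2 (divX (wordPoly c)) := by
        ext t
        rw [coeff_contract two_ne_zero]
        obtain _ | t := t
        · simp
        · rw [coeff_X_mul, coeff_contract two_ne_zero, coeff_divX,
            show (t + 1) * 2 = (t * 2 + 1) + 1 by ring, coeff_X_mul]
      refine hcop.dvd_of_dvd_mul_left ?_
      rw [← h2]
      obtain ⟨q, hq⟩ := h
      rw [hq, ← hexp, show X * (expand F 2 ((X - C a) ^ j) * q) =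
        (X * q) * expand F 2 ((X - C a) ^ j) by ring, contract_mul_expand two_ne_zero]
      exact dvd_mul_left _ _
  · refine key 0 _ (by omega) h0 (fun t => ?_) ?_
    · rw [coeff_contract two_ne_zero, mul_comm, add_zero]
    · obtain ⟨q, hq⟩ := h
      rw [hq, ← hexp, mul_comm, contract_mul_expand two_ne_zero]
      exact dvd_mul_left _ _

/-- Two adjacent zeros can be rotated into the top two positions; what is left has degree below that
of `g`, so the word would vanish. -/
theorem pairWeight_eq_length {g : F[X]} {α : F} (hα : α ≠ 0) (hg : g ∣ X ^ N - C α)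
    (hN : g.natDegree + 2 = N) {c : Fin N → F} (hc : c ∈ multipleCode N g) (h0 : c ≠ 0) :
    pairWeight c = N := by
  refine pairWeight_eq_of_forall_ne_zero fun i => ?_
  by_contra! hi
  obtain ⟨c', hc', -, e, he, hcomm, hz⟩ := exists_rotate (isUnit_iff_ne_zero.2 hα)
    (fun c hc => constaShift_mem_multipleCode (by omega) hg hc) hc i ⟨g.natDegree, by omega⟩
  have h1 : c' = 0 := by
    refine eq_zero_of_mem_multipleCode hc' fun l hl => ?_
    obtain ⟨k, rfl⟩ := e.surjective l
    rw [hz]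
    rcases hl.eq_or_lt with h | h
    · have : e k = e i := by rw [he]; exact Fin.ext h.symm
      rw [e.injective this, hi.1]
    · have : e k = e (finRotate N i) := by
        rw [hcomm, he]
        ext
        rw [val_finRotate]
        have := (e k).2
        simp only
        rw [Nat.mod_eq_of_lt (by omega)]
        omega
      rw [e.injective this, hi.2]
  exact h0 (funext fun k => (hz k).1 (by rw [h1]; rfl))

theorem exists_rotate_run {α : F} (hα : α ≠ 0) {g : F[X]} (hg : g ∣ X ^ N - C α) (hN : 0 < N)
    {c : Fin N → F} (hc : c ∈ multipleCode N g) (h0 : c ≠ 0) (h : ∃ i, c i = 0) :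
    ∃ c' ∈ multipleCode N g, pairWeight c' = pairWeight c ∧ c' ⟨N - 1, by omega⟩ = 0 ∧
      c' ⟨0, hN⟩ ≠ 0 := by
  obtain ⟨i, hi, hi'⟩ := exists_eq_zero_finRotate_ne_zero h0 h
  obtain ⟨c', hc', hw, e, he, hcomm, hz⟩ := exists_rotate (isUnit_iff_ne_zero.2 hα)
    (fun c hc => constaShift_mem_multipleCode hN hg hc) hc i ⟨N - 1, by omega⟩
  refine ⟨c', hc', hw, ?_, ?_⟩
  · rw [← he, hz, hi]
  · have : (⟨0, hN⟩ : Fin N) = e (finRotate N i) := by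
      rw [hcomm, he]
      ext
      rw [val_finRotate]
      simp [Nat.sub_add_cancel hN]
    rw [this, ne_eq, hz]
    exact hi'

/-- Rotate so that a run starts at 0 after a zero at `N - 1`. Since `g` has degree 2, some entry `i
≥ 2` is nonzero, and then 0, `i - 1`, `i`, `N - 1` are four distinct positions of the pair support.
-/
theorem four_le_pairWeight {α : F} (hα : α ≠ 0) {g : F[X]} (hg : g ∣ X ^ N - C α) (hN : 4 ≤ N)
    (hdeg : g.natDegree = 2) {c : Fin N → F} (hc : c ∈ multipleCode N g) (h0 : c ≠ 0) :
    4 ≤ pairWeight c := by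
  by_cases h : ∃ i, c i = 0
  swap
  · push Not at h
    rwa [pairWeight_eq_of_forall_ne_zero fun i => Or.inl (h i)]
  obtain ⟨c', hc', hw, hl, hf⟩ := exists_rotate_run hα hg (by omega) hc h0 h
  rw [← hw]
  by_contra! hlt
  refine hf (congrFun (eq_zero_of_mem_multipleCode hc' fun i hi => ?_) _)
  by_contra hi0
  rw [hdeg] at hi
  have hiN : (i : ℕ) ≠ N - 1 := fun h => hi0 (by rw [← hl]; congr 1; exact Fin.ext h)
  have hi2 := i.2
  have hsub : ({0, (i : ℕ) - 1, (i : ℕ), N - 1} : Finset ℕ) ⊆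
      (pairSupport c').map Fin.valEmbedding := by
    intro k hk
    simp only [Finset.mem_insert, Finset.mem_singleton] at hk
    simp only [Finset.mem_map, mem_pairSupport, Fin.valEmbedding_apply]
    rcases hk with rfl | rfl | rfl | rfl
    · exact ⟨⟨0, by omega⟩, Or.inl hf, rfl⟩
    · refine ⟨⟨i - 1, by omega⟩, Or.inr ?_, rfl⟩
      convert hi0
      ext
      rw [val_finRotate]
      simp only
      rw [Nat.sub_add_cancel (by omega), Nat.mod_eq_of_lt hi2]
    · exact ⟨i, Or.inl hi0, rfl⟩
    · refine ⟨⟨N - 1, by omega⟩, Or.inr ?_, rfl⟩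
      convert hf
      rw [val_finRotate]
      simp only
      rw [Nat.sub_add_cancel (by omega), Nat.mod_self]
  have h4 := Finset.card_le_card hsub
  rw [Finset.card_map] at h4
  have : ({0, (i : ℕ) - 1, (i : ℕ), N - 1} : Finset ℕ).card = 4 := by
    rw [Finset.card_insert_of_notMem, Finset.card_insert_of_notMem, Finset.card_insert_of_notMem,
      Finset.card_singleton] <;> simp only [Finset.mem_insert, Finset.mem_singleton] <;> omega
  rw [pairWeight] at hlt
  omega

end MultipleCode

/-! ### The exceptional code of length nine in characteristic three -/

section LengthNine

variable {F : Type*} [Field F]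

/-- The bits record nonzero entries of a word with entry 0 nonzero and entry 8 zero; the summand 2
counts the pair positions 0 and 8. The possible supports are {0, 3} and {0, 6}. -/
theorem zero_pattern_of_length_nine : ∀ b₁ b₂ b₃ b₄ b₅ b₆ b₇ : Bool,
    2 + (b₁ || b₂).toNat + (b₂ || b₃).toNat + (b₃ || b₄).toNat + (b₄ || b₅).toNat +
      (b₅ || b₆).toNat + (b₆ || b₇).toNat + b₇.toNat ≤ 5 →
    (b₃ || b₆) → b₁.toNat + b₄.toNat + b₇.toNat ≠ 1 → b₂.toNat + b₅.toNat ≠ 1 →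
    b₁ = false ∧ b₂ = false ∧ b₄ = false ∧ b₅ = false ∧ b₇ = false ∧
      (b₃ = false ∨ b₆ = false) := by
  rintro (_ | _) (_ | _) (_ | _) <;> decide

open Classical in
theorem toNat_decide_add_ne_one {b x y z : F} (hb : b ≠ 0) (h : x + b * y + b ^ 2 * z = 0) :
    (decide (x ≠ 0)).toNat + (decide (y ≠ 0)).toNat + (decide (z ≠ 0)).toNat ≠ 1 := by
  by_cases hx : x = 0 <;> by_cases hy : y = 0 <;> by_cases hz : z = 0 <;> simp_all

theorem six_le_pairWeight [CharP F 3] {a : F} (ha : a ≠ 0) {c : Fin 9 → F}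
    (hc : c ∈ multipleCode 9 ((X - C a) ^ 4)) (h0 : c ≠ 0) : 6 ≤ pairWeight c := by
  classical
  have : Fact (Nat.Prime 3) := ⟨Nat.prime_three⟩
  by_cases h : ∃ i, c i = 0
  swap
  · push Not at h
    rw [pairWeight_eq_of_forall_ne_zero fun i => Or.inl (h i)]
    norm_num
  have hα : (X - C a) ^ 9 = X ^ 9 - C (a ^ 9) := by
    rw [C_pow]
    exact sub_pow_char_pow (p := 3) (n := 2) X (C a)
  have hdvd : (X - C a) ^ 4 ∣ X ^ 9 - C (a ^ 9) := hα ▸ pow_dvd_pow _ (by norm_num)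
  obtain ⟨c', hc', hw, hl, hf⟩ :=
    exists_rotate_run (pow_ne_zero 9 ha) hdvd (by norm_num) hc h0 h
  rw [← hw]
  clear hw h h0 hc c
  rename' c' => c
  by_contra! hlt
  change c 8 = 0 at hl
  change c 0 ≠ 0 at hf
  have hb : a ^ 3 ≠ 0 := pow_ne_zero 3 ha
  have hcube : (X - C a) ^ 3 = X ^ 3 - C (a ^ 3) := by
    rw [C_pow]
    exact sub_pow_char (p := 3) X (C a)
  obtain ⟨q, hq⟩ : X ^ 3 - C (a ^ 3) ∣ wordPoly c :=
    hcube ▸ (pow_dvd_pow _ (by norm_num)).trans hc'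
  have hqd : ∀ k, 6 ≤ k → q.coeff k = 0 := by
    rw [← degree_lt_iff_coeff_zero]
    by_cases hq0 : q = 0
    · rw [hq0, degree_zero]; exact WithBot.bot_lt_coe _
    · have h1 := degree_wordPoly_lt c
      rw [hq, degree_mul, degree_X_pow_sub_C (by norm_num), degree_eq_natDegree hq0] at h1
      rw [degree_eq_natDegree hq0]
      norm_cast at h1 ⊢
      omega
  have hco : ∀ k, (wordPoly c).coeff k = (if 3 ≤ k then q.coeff (k - 3) else 0) -
      a ^ 3 * q.coeff k := by
    intro k
    rw [hq, sub_mul, coeff_sub, coeff_C_mul, coeff_X_pow_mul']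
  -- Divisibility by X^3 - a^3 is one linear relation for each residue class of exponents modulo 3,
  -- so no class contains exactly one nonzero entry.
  have hclass : ∀ k, k < 3 → (wordPoly c).coeff k + a ^ 3 * (wordPoly c).coeff (k + 3) +
      (a ^ 3) ^ 2 * (wordPoly c).coeff (k + 6) = 0 := by
    intro k hk
    rw [hco k, hco (k + 3), hco (k + 6), if_neg (by omega), if_pos (by omega), if_pos (by omega),
      hqd (k + 6) (by omega), Nat.add_sub_cancel, show k + 6 - 3 = k + 3 by omega]
    ring
  have e0 : c 0 + a ^ 3 * c 3 + (a ^ 3) ^ 2 * c 6 = 0 := by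
    simpa [coeff_wordPoly] using hclass 0 (by norm_num)
  have e1 : c 1 + a ^ 3 * c 4 + (a ^ 3) ^ 2 * c 7 = 0 := by
    simpa [coeff_wordPoly] using hclass 1 (by norm_num)
  have e2 : c 2 + a ^ 3 * c 5 + (a ^ 3) ^ 2 * c 8 = 0 := by
    simpa [coeff_wordPoly] using hclass 2 (by norm_num)
  have hpat := zero_pattern_of_length_nine (decide (c 1 ≠ 0)) (decide (c 2 ≠ 0))
    (decide (c 3 ≠ 0)) (decide (c 4 ≠ 0)) (decide (c 5 ≠ 0)) (decide (c 6 ≠ 0))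
    (decide (c 7 ≠ 0)) ?_ ?_ (toNat_decide_add_ne_one hb e1) ?_
  · simp only [decide_eq_false_iff_not, not_not] at hpat
    obtain ⟨h1, h2, h4, h5, h7, h36⟩ := hpat
    rcases h36 with h3 | h6
    · have hw : wordPoly c = C (c 0) + C (c 6) * X ^ 6 := by
        simp [wordPoly, Fin.sum_univ_succ, h1, h2, h3, h4, h5, h7, hl]
      -- Support {0, 6}: multiplying by X^3 and reducing modulo X^9 - a^9 gives degree 3, too small
      -- for a nonzero multiple of a quartic.
      have hd : (X - C a) ^ 4 ∣ C (c 0) * X ^ 3 + C (c 6 * a ^ 9) := by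
        have : C (c 0) * X ^ 3 + C (c 6 * a ^ 9) =
            X ^ 3 * wordPoly c - C (c 6) * (X ^ 9 - C (a ^ 9)) := by
          rw [hw, C_mul]; ring
        rw [this]
        exact dvd_sub (hc'.mul_left _) (hdvd.mul_left _)
      have hz := eq_zero_of_dvd_of_natDegree_lt hd ?_
      · have := congrArg (fun g => coeff g 3) hz
        simp only [coeff_add, coeff_C_mul, coeff_X_pow, if_true, coeff_C, coeff_zero] at this
        simp at this
        exact hf this
      · rw [natDegree_pow, natDegree_X_sub_C]
        compute_degree
        norm_num
    · have hw := eq_zero_of_mem_multipleCode hc' fun i hi => ?_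
      · exact hf (by rw [hw]; rfl)
      · rw [natDegree_pow, natDegree_X_sub_C] at hi
        fin_cases i <;> first | (exfalso; revert hi; decide) | assumption
  · have hP : pairWeight c = ∑ i : Fin 9, (decide (c i ≠ 0) || decide (c (i + 1) ≠ 0)).toNat := by
      rw [pairWeight, pairSupport, Finset.card_filter]
      refine Finset.sum_congr rfl fun i _ => ?_
      rw [finRotate_apply]
      by_cases h1 : c i = 0 <;> by_cases h2 : c (i + 1) = 0 <;> simp [h1, h2]
    have hS := hP ▸ Nat.lt_succ_iff.1 hlt
    rw [Fin.sum_univ_castSucc, Fin.sum_univ_eight] at hS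
    change (decide (c 0 ≠ 0) || decide (c (0 + 1) ≠ 0)).toNat +
      (decide (c 1 ≠ 0) || decide (c (1 + 1) ≠ 0)).toNat +
      (decide (c 2 ≠ 0) || decide (c (2 + 1) ≠ 0)).toNat +
      (decide (c 3 ≠ 0) || decide (c (3 + 1) ≠ 0)).toNat +
      (decide (c 4 ≠ 0) || decide (c (4 + 1) ≠ 0)).toNat +
      (decide (c 5 ≠ 0) || decide (c (5 + 1) ≠ 0)).toNat +
      (decide (c 6 ≠ 0) || decide (c (6 + 1) ≠ 0)).toNat +
      (decide (c 7 ≠ 0) || decide (c (7 + 1) ≠ 0)).toNat +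
      (decide (c 8 ≠ 0) || decide (c (8 + 1) ≠ 0)).toNat ≤ 5 at hS
    have t0 : (0 : Fin 9) + 1 = 1 := rfl
    have t1 : (1 : Fin 9) + 1 = 2 := rfl
    have t2 : (2 : Fin 9) + 1 = 3 := rfl
    have t3 : (3 : Fin 9) + 1 = 4 := rfl
    have t4 : (4 : Fin 9) + 1 = 5 := rfl
    have t5 : (5 : Fin 9) + 1 = 6 := rfl
    have t6 : (6 : Fin 9) + 1 = 7 := rfl
    have t7 : (7 : Fin 9) + 1 = 8 := rfl
    have t8 : (8 : Fin 9) + 1 = 0 := rfl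
    rw [t0, t1, t2, t3, t4, t5, t6, t7, t8] at hS
    have d0 : decide (c 0 ≠ 0) = true := by simpa using hf
    have d8 : decide (c 8 ≠ 0) = false := by simpa using hl
    rw [d0, d8, Bool.true_or, Bool.or_false, Bool.false_or, Bool.toNat_true] at hS
    omega
  · by_contra hcon
    simp only [Bool.or_eq_true, decide_eq_true_eq, not_or, not_not] at hcon
    rw [hcon.1, hcon.2, mul_zero, mul_zero, add_zero, add_zero] at e0
    exact hf e0
  · have := toNat_decide_add_ne_one hb e2
    rw [hl] at this
    simpa using this

end LengthNine

/-! ### Powers of a binomial: upper bounds and the table rows -/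

section BinomialPower

variable {F : Type*} [Field F]

theorem card_support_expand_le {q : ℕ} (hq : 0 < q) (h : F[X]) :
    (expand F q h).support.card ≤ h.natDegree + 1 := by
  classical
  refine le_trans ?_ h.card_supp_le_succ_natDegree
  refine (Finset.card_le_card fun k hk => ?_).trans (Finset.card_image_le (f := fun i => i * q))
  rw [mem_support_iff, coeff_expand hq] at hk
  split_ifs at hk with hd
  · exact Finset.mem_image.2 ⟨k / q, mem_support_iff.2 hk, Nat.div_mul_cancel hd⟩
  · exact absurd rfl hk

theorem card_support_X_pow_sub_C_pow_le {q : ℕ} (hq : 0 < q) (a : F) (i : ℕ) :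
    ((X ^ q - C a) ^ i).support.card ≤ i + 1 := by
  have h := card_support_expand_le hq ((X - C a) ^ i)
  rwa [natDegree_pow, natDegree_X_sub_C, mul_one, map_pow, map_sub, expand_X, expand_C] at h

theorem natDegree_X_pow_sub_C_pow (n : ℕ) (a : F) (i : ℕ) :
    ((X ^ n - C a) ^ i).natDegree = n * i := by
  rw [natDegree_pow, natDegree_X_pow_sub_C, mul_comm]

theorem monic_X_pow_sub_C_pow {n : ℕ} (hn : 0 < n) (a : F) (i : ℕ) :
    ((X ^ n - C a) ^ i).Monic :=
  (monic_X_pow_sub_C a hn.ne').pow i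

theorem X_pow_sub_C_pow_char_pow (p : ℕ) [CharP F p] (hp : p.Prime) (n s : ℕ) (a : F) :
    (X ^ n - C a) ^ p ^ s = X ^ (n * p ^ s) - C (a ^ p ^ s) := by
  have : Fact p.Prime := ⟨hp⟩
  rw [sub_pow_char_pow, C_pow, pow_mul]

variable {N n M : ℕ} {a : F}

theorem minPairDist_multipleCode_le_of_dvd {g h : F[X]} (hgh : g ∣ h) (hh : h.Monic)
    (hdeg : h.natDegree < N) :
    minPairDist (multipleCode N g : Set (Fin N → F)) ≤ pairWeight (polyWord N h) := by
  have hd : h.degree < N := (natDegree_lt_iff_degree_lt hh.ne_zero).1 hdeg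
  exact minPairDist_le _ (polyWord_mem_multipleCode hd hgh) (polyWord_ne_zero hd hh.ne_zero)

theorem minPairDist_multipleCode_le_length {g h : F[X]} (hgh : g ∣ h) (hh : h.Monic)
    (hdeg : h.natDegree < N) : minPairDist (multipleCode N g : Set (Fin N → F)) ≤ N :=
  (minPairDist_multipleCode_le_of_dvd hgh hh hdeg).trans (pairWeight_le _)

theorem multipleCode_ne_bot {g h : F[X]} (hgh : g ∣ h) (hh : h.Monic) (hdeg : h.natDegree < N) :
    multipleCode N g ≠ ⊥ := by
  have hd : h.degree < N := (natDegree_lt_iff_degree_lt hh.ne_zero).1 hdeg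
  exact (Submodule.ne_bot_iff _).2 ⟨_, polyWord_mem_multipleCode hd hgh,
    polyWord_ne_zero hd hh.ne_zero⟩

/-- The generator itself is a single block of `n * j + 1` coefficients. -/
theorem minPairDist_multipleCode_le (hn : 0 < n) {j : ℕ} (hj : j < M) :
    minPairDist (multipleCode (n * M) ((X ^ n - C a) ^ j) : Set (Fin (n * M) → F)) ≤
      n * j + 2 := by
  have hdeg := natDegree_X_pow_sub_C_pow n a j
  refine (minPairDist_multipleCode_le_of_dvd dvd_rfl (monic_X_pow_sub_C_pow hn a j)
    (by rw [hdeg]; exact Nat.mul_lt_mul_of_pos_left hj hn)).trans ?_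
  rw [← one_mul ((X ^ n - C a) ^ j)]
  refine (pairWeight_polyWord_mul_le _ _ hdeg.le).trans ?_
  simpa using Nat.mul_le_mul_right (n * j + 2)
    (card_support_C_mul_X_pow_le_one (c := (1 : F)) (n := 0))

theorem minPairDist_multipleCode_le_of_card_support {g h : F[X]} (hgh : g ∣ h) (hh : h.Monic)
    (hdeg : h.natDegree < N) {w : ℕ} (hw : h.support.card ≤ w) :
    minPairDist (multipleCode N g : Set (Fin N → F)) ≤ w * 2 := by
  refine (minPairDist_multipleCode_le_of_dvd hgh hh hdeg).trans ?_
  rw [← mul_one h]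
  refine (pairWeight_polyWord_mul_le h 1 (e := 0) (by simp)).trans ?_
  rw [zero_add]
  exact Nat.mul_le_mul_right _ hw

theorem minPairDist_multipleCode_le_two_mul (hn : 0 < n) {j : ℕ} (hj : j < M) :
    minPairDist (multipleCode (n * M) ((X ^ n - C a) ^ j) : Set (Fin (n * M) → F)) ≤
      (j + 1) * 2 :=
  minPairDist_multipleCode_le_of_card_support dvd_rfl (monic_X_pow_sub_C_pow hn a j)
    (by rw [natDegree_X_pow_sub_C_pow]; exact Nat.mul_lt_mul_of_pos_left hj hn)
    (card_support_X_pow_sub_C_pow_le hn a j)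

/-- The codeword is f^(e·p^s), the `e`-th power of a binomial, hence of at most `e + 1` terms; `e <
p` keeps its degree below the length. -/
theorem minPairDist_multipleCode_le_of_le_mul {p : ℕ} [CharP F p] (hp : p.Prime) (hn : 0 < n)
    {s j e : ℕ} (hj : j ≤ e * p ^ s) (he : e < p) :
    minPairDist (multipleCode (n * p ^ (s + 1)) ((X ^ n - C a) ^ j) :
      Set (Fin (n * p ^ (s + 1)) → F)) ≤ (e + 1) * 2 := by
  refine minPairDist_multipleCode_le_of_card_support (pow_dvd_pow _ hj)
    (monic_X_pow_sub_C_pow hn a _) ?_ ?_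
  · rw [natDegree_X_pow_sub_C_pow, pow_succ']
    exact Nat.mul_lt_mul_of_pos_left (Nat.mul_lt_mul_of_pos_right he (pow_pos hp.pos s)) hn
  · rw [mul_comm, pow_mul, X_pow_sub_C_pow_char_pow p hp]
    exact card_support_X_pow_sub_C_pow_le (Nat.mul_pos hn (pow_pos hp.pos s)) _ _

theorem X_pow_sub_C_pow_add {p : ℕ} [CharP F p] (hp : p.Prime) (n s e i : ℕ) (a : F) :
    (X ^ n - C a) ^ (e * p ^ s + i) =
      (X ^ (n * p ^ s) - C (a ^ p ^ s)) ^ e * (X ^ n - C a) ^ i := by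
  rw [pow_add, mul_comm e, pow_mul, X_pow_sub_C_pow_char_pow p hp]

theorem minPairDist_multipleCode_add_le {p : ℕ} [CharP F p] (hp : p.Prime) (hn : 0 < n)
    {s e i : ℕ} (hj : e * p ^ s + i < M) :
    minPairDist (multipleCode (n * M) ((X ^ n - C a) ^ (e * p ^ s + i)) :
      Set (Fin (n * M) → F)) ≤ (e + 1) * (n * i + 2) := by
  refine (minPairDist_multipleCode_le_of_dvd dvd_rfl (monic_X_pow_sub_C_pow hn a _)
    (by rw [natDegree_X_pow_sub_C_pow]; exact Nat.mul_lt_mul_of_pos_left hj hn)).trans ?_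
  rw [X_pow_sub_C_pow_add hp]
  exact (pairWeight_polyWord_mul_le _ _ (natDegree_X_pow_sub_C_pow n a i).le).trans
    (Nat.mul_le_mul_right _
      (card_support_X_pow_sub_C_pow_le (Nat.mul_pos hn (pow_pos hp.pos s)) _ _))

theorem minPairDist_multipleCode_add_le_two_mul {p : ℕ} [CharP F p] (hp : p.Prime) (hn : 0 < n)
    {s e i : ℕ} (hj : e * p ^ s + i < M) :
    minPairDist (multipleCode (n * M) ((X ^ n - C a) ^ (e * p ^ s + i)) :
      Set (Fin (n * M) → F)) ≤ (e + 1) * (i + 1) * 2 := by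
  refine minPairDist_multipleCode_le_of_card_support dvd_rfl (monic_X_pow_sub_C_pow hn a _)
    (by rw [natDegree_X_pow_sub_C_pow]; exact Nat.mul_lt_mul_of_pos_left hj hn) ?_
  rw [X_pow_sub_C_pow_add hp]
  exact card_support_mul_le.trans (Nat.mul_le_mul
    (card_support_X_pow_sub_C_pow_le (Nat.mul_pos hn (pow_pos hp.pos s)) _ _)
    (card_support_X_pow_sub_C_pow_le hn _ _))

/-- This puts all rows into one shape, so that size and distance can be verified uniformly. -/
theorem TableRow.bounds {p m s j k size d : ℕ} (hp : p.Prime) (hs : 1 ≤ s)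
    (h : TableRow p m n s j k size d) :
    1 ≤ j ∧ j < p ^ s ∧ k < j ∧ 2 * j ≤ p ^ s + k ∧
      size = (p ^ m) ^ (2 * (n * p ^ s - n * j)) ∧ d = n * j + 2 := by
  have h2 := hp.two_le
  have hps : p ≤ p ^ s := Nat.le_self_pow (by omega) p
  cases h with
  | row1 s h =>
    refine ⟨by omega, by omega, by omega, by omega, ?_, by omega⟩
    rw [← pow_mul]; congr 1; rw [one_mul, one_mul]; ring
  | row2 s k hs hk =>
    have h4 : 2 ^ 2 ≤ p ^ s := (Nat.pow_le_pow_left h2 2).trans (Nat.pow_le_pow_right hp.pos hs)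
    refine ⟨by omega, by omega, by omega, by omega, ?_, by omega⟩
    rw [← pow_mul]; congr 1; rw [one_mul, one_mul]; ring
  | row3 k hp hk =>
    subst hp
    refine ⟨by omega, by omega, by omega, by omega, ?_, by omega⟩
    rw [← pow_mul]; congr 1; omega
  | row4 j k hj hjp hk hkj =>
    rw [pow_one]
    refine ⟨by omega, by omega, by omega, by omega, ?_, by omega⟩
    rw [← pow_mul]; congr 1; rw [one_mul, one_mul]; ring
  | row5 s k hk =>
    refine ⟨by omega, by omega, by omega, by omega, ?_, by omega⟩
    rw [← pow_mul]; congr 1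
    rw [one_mul, one_mul, show p ^ s - (p ^ s - 2) = 2 by omega]; ring
  | row6 s =>
    refine ⟨by omega, by omega, by omega, by omega, ?_, by omega⟩
    rw [← pow_mul]; congr 1; rw [← Nat.mul_sub]; ring
  | row7 j k hj hjp hk hkj =>
    rw [pow_one]
    refine ⟨by omega, by omega, by omega, by omega, ?_, by omega⟩
    rw [← pow_mul]; congr 1; rw [← Nat.mul_sub]; ring
  | row8 s =>
    refine ⟨by omega, by omega, by omega, by omega, ?_, by omega⟩
    rw [← pow_mul]; congr 1
    rw [← Nat.mul_sub, show p ^ s - (p ^ s - 1) = 1 by omega]; ring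

theorem TableRow.le_pairWeight {p m s j k size d : ℕ} [CharP F p] (hp : p.Prime) (hs : 1 ≤ s)
    (ha : a ≠ 0) (h : TableRow p m n s j k size d) {c : Fin (n * p ^ s) → F}
    (hc : c ∈ multipleCode (n * p ^ s) ((X ^ n - C a) ^ j)) (h0 : c ≠ 0) :
    n * j + 2 ≤ pairWeight c := by
  have h2 := hp.two_le
  have hps : p ≤ p ^ s := Nat.le_self_pow (by omega) p
  obtain ⟨hj1, hjs, -, -, -, -⟩ := h.bounds hp hs
  have hα : a ^ p ^ s ≠ 0 := pow_ne_zero _ ha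
  have hdvd : (X ^ n - C a) ^ j ∣ X ^ (n * p ^ s) - C (a ^ p ^ s) := by
    rw [← X_pow_sub_C_pow_char_pow p hp]
    exact pow_dvd_pow _ hjs.le
  have hdeg := natDegree_X_pow_sub_C_pow n a j
  have hone : ∀ G : F[X], G ≠ 0 → (X - C a) ^ 1 ∣ G → 1 < G.support.card := fun G hG hd =>
    two_le_card_support ha hG (by rwa [pow_one] at hd)
  have hW : ∀ j, ∀ G : F[X], G ≠ 0 → G.degree < p → (X - C a) ^ j ∣ G → j < G.support.card :=
    fun j G hG hd hG' => lt_card_support_of_pow_dvd p ha j hG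
      ((natDegree_lt_iff_degree_lt hG).2 hd) hG'
  have h1 : wordPoly c ≠ 0 := wordPoly_eq_zero.not.2 h0
  have hcd : (wordPoly c).degree < (n * p ^ s : ℕ) := degree_wordPoly_lt c
  cases h with
  | row1 s h =>
    rw [mem_multipleCode, pow_one X] at hc
    rw [one_mul]
    exact add_two_le_pairWeight (by omega) h0 (hone _ h1 hc)
  | row2 s k hs hk =>
    have h4 : 2 ^ 2 ≤ p ^ s := (Nat.pow_le_pow_left h2 2).trans (Nat.pow_le_pow_right hp.pos hs)
    exact four_le_pairWeight hα hdvd (by omega) hdeg hc h0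
  | row3 k hp hk =>
    subst hp
    rw [pow_one X] at hc
    exact six_le_pairWeight ha hc h0
  | row4 j k hj hjp hk hkj =>
    rw [mem_multipleCode, pow_one X] at hc
    rw [one_mul]
    refine add_two_le_pairWeight (by rw [one_mul, pow_one]; exact hjp) h0 (hW j _ h1 ?_ hc)
    exact hcd.trans_eq (by rw [one_mul, pow_one])
  | row5 s k hk =>
    rw [pairWeight_eq_length hα hdvd (by rw [hdeg]; omega) hc h0]
    omega
  | row6 s =>
    exact two_mul_add_two_le_pairWeight rfl ha (fun G hG _ => hone G hG) h0 hc
  | row7 j k hj hjp hk hkj =>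
    exact two_mul_add_two_le_pairWeight rfl ha (by rw [pow_one]; exact hW j) h0 hc
  | row8 s =>
    rw [pairWeight_eq_length hα hdvd (by rw [hdeg]; omega) hc h0]
    omega

theorem TableRow.minPairDist_eq {p m s j k size d : ℕ} [CharP F p] (hp : p.Prime) (hs : 1 ≤ s)
    (hn : 0 < n) (ha : a ≠ 0) (h : TableRow p m n s j k size d) :
    minPairDist (multipleCode (n * p ^ s) ((X ^ n - C a) ^ j) :
      Set (Fin (n * p ^ s) → F)) = n * j + 2 := by
  obtain ⟨-, hjs, -, -, -, -⟩ := h.bounds hp hs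
  refine le_antisymm (minPairDist_multipleCode_le hn hjs) ?_
  obtain ⟨c, hc, h0, hw⟩ := exists_pairWeight_eq_minPairDist
    (multipleCode (n * p ^ s) ((X ^ n - C a) ^ j)) (multipleCode_ne_bot dvd_rfl
      (monic_X_pow_sub_C_pow hn a j)
      (by rw [natDegree_X_pow_sub_C_pow]; exact Nat.mul_lt_mul_of_pos_left hjs hn))
  rw [← hw]
  exact h.le_pairWeight hp hs ha hc h0

theorem length_le_two_of_minPairDist_eq {j : ℕ} (hn : 0 < n) (hj1 : 1 ≤ j) (hj : j < M)
    (hd : minPairDist (multipleCode (n * M) ((X ^ n - C a) ^ j) : Set (Fin (n * M) → F)) =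
      n * j + 2) : n = 1 ∨ n = 2 := by
  have h := minPairDist_multipleCode_le_two_mul (a := a) hn hj
  rw [hd] at h
  by_contra hcon
  have h3 : 3 * j ≤ n * j := Nat.mul_le_mul_right j (by omega)
  omega

/-- The distances that repeated-root constacyclic codes of length `n * p ^ (s + 2)` cannot
exceed: either the exponent `j` is at most `(t + 1) * p ^ (s + 1)` with `t + 1 < p`, or it lies in
the last block. -/
theorem exists_minPairDist_le {p : ℕ} [CharP F p] (hp : p.Prime) (hn : 0 < n) {s j : ℕ}
    (hj1 : 1 ≤ j) (hj : j < p ^ (s + 2)) :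
    (∃ t, t + 2 ≤ p ∧ t * p ^ (s + 1) + 1 ≤ j ∧
      minPairDist (multipleCode (n * p ^ (s + 2)) ((X ^ n - C a) ^ j) :
        Set (Fin (n * p ^ (s + 2)) → F)) ≤ (t + 2) * 2) ∨
    ∃ i r, p = r + 1 ∧ j = r * p ^ (s + 1) + i ∧
      minPairDist (multipleCode (n * p ^ (s + 2)) ((X ^ n - C a) ^ j) :
        Set (Fin (n * p ^ (s + 2)) → F)) ≤ (r + 1) * (n * i + 2) ∧
      minPairDist (multipleCode (n * p ^ (s + 2)) ((X ^ n - C a) ^ j) :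
        Set (Fin (n * p ^ (s + 2)) → F)) ≤ (r + 1) * (i + 1) * 2 := by
  have hp2 := hp.two_le
  have hP : 0 < p ^ (s + 1) := pow_pos hp.pos _
  rcases le_or_gt j ((p - 1) * p ^ (s + 1)) with h | h
  -- Dividing `j - 1` rather than `j` gives t·P < j ≤ (t+1)·P with P = p^(s+1), so that f^((t+1)P)
  -- is a multiple of f^j.
  · left
    have ht : (j - 1) / p ^ (s + 1) < p - 1 :=
      Nat.div_lt_of_lt_mul (by rw [mul_comm]; omega)
    have hle := Nat.div_mul_le_self (j - 1) (p ^ (s + 1))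
    have hlt := Nat.lt_div_mul_add (a := j - 1) hP
    refine ⟨(j - 1) / p ^ (s + 1), by omega, by omega, ?_⟩
    refine minPairDist_multipleCode_le_of_le_mul hp hn (e := (j - 1) / p ^ (s + 1) + 1) ?_
      (by omega)
    rw [add_mul]
    omega
  · right
    obtain ⟨i, rfl⟩ := Nat.exists_eq_add_of_le h.le
    exact ⟨i, p - 1, by omega, rfl, minPairDist_multipleCode_add_le hp hn hj,
      minPairDist_multipleCode_add_le_two_mul hp hn hj⟩

theorem exists_tableRow_one {p m s j k : ℕ} [CharP F p] (hp : p.Prime) (hs : 1 ≤ s)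
    (hj : j < p ^ s) (hk : k < j) (hjk : 2 * j ≤ p ^ s + k)
    (hd : minPairDist (multipleCode (1 * p ^ s) ((X ^ 1 - C a) ^ j) :
      Set (Fin (1 * p ^ s) → F)) = 1 * j + 2) :
    ∃ size d, TableRow p m 1 s j k size d := by
  have hp2 := hp.two_le
  have hlen : minPairDist (multipleCode (1 * p ^ s) ((X ^ 1 - C a) ^ j) :
      Set (Fin (1 * p ^ s) → F)) ≤ 1 * p ^ s :=
    minPairDist_multipleCode_le_length dvd_rfl (monic_X_pow_sub_C_pow one_pos a j)
      (by rw [natDegree_X_pow_sub_C_pow]; omega)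
  rw [hd] at hlen
  obtain _ | _ | s := s
  · omega
  · rw [zero_add, pow_one] at *
    exact ⟨_, _, .row4 j k (by omega) (by omega) hjk hk⟩
  simp only [add_assoc, Nat.reduceAdd] at *
  have hP : p ≤ p ^ (s + 1) := Nat.le_self_pow (by omega) p
  have hpow : p ^ (s + 2) = p * p ^ (s + 1) := pow_succ' _ _
  have h4 : 2 * 2 ≤ p * p ^ (s + 1) := Nat.mul_le_mul hp2 (hp2.trans hP)
  by_cases hj1 : j = 1
  · obtain rfl : k = 0 := by omega
    subst hj1
    exact ⟨_, _, .row1 _ (by omega)⟩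
  by_cases hj2 : j = 2
  · subst hj2
    exact ⟨_, _, .row2 _ k (by omega) (by omega)⟩
  by_cases hj3 : j + 2 = p ^ (s + 2)
  · obtain rfl : j = p ^ (s + 2) - 2 := by omega
    exact ⟨_, _, .row5 _ k (by omega)⟩
  -- With P = p^(s+1), the first case gives tP + 1 ≤ j ≤ 2t + 2. Here t ≥ 1 since j ≥ 3, and P ≥ p ≥
  -- t + 2 ≥ 3, which leaves only t = 1, P = p = 3, j = 4. The last block would need P ≤ i + 2, but
  -- j + 2 < p^(s+2) gives i + 2 < P.
  rcases exists_minPairDist_le (a := a) hp one_pos (by omega : 1 ≤ j) hj with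
    ⟨t, ht, htj, hle⟩ | ⟨i, r, rfl, rfl, hle, -⟩
  · rw [hd] at hle
    have ht0 : t ≠ 0 := by rintro rfl; omega
    have h3 : t * 3 ≤ t * p ^ (s + 1) := Nat.mul_le_mul_left t (by omega)
    obtain rfl : t = 1 := by omega
    obtain rfl : p = 3 := by omega
    obtain rfl : s = 0 := by
      have : 3 ^ (s + 1) ≤ 3 ^ 1 := by omega
      have := (Nat.pow_le_pow_iff_right (by norm_num)).1 this
      omega
    obtain rfl : j = 4 := by omega
    exact ⟨_, _, .row3 k rfl (by omega)⟩
  · rw [hd] at hle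
    exfalso
    have hlt : r * (i + 2) < r * (r + 1) ^ (s + 1) := by
      refine Nat.mul_lt_mul_of_pos_left ?_ (by omega)
      rw [hpow, add_mul, one_mul] at hj hlen hj3
      omega
    have h5 : (r + 1) * (1 * i + 2) = r * (i + 2) + (i + 2) := by ring
    omega

theorem exists_tableRow_two {p m s j k : ℕ} [CharP F p] (hp : p.Prime) (hs : 1 ≤ s)
    (hj : j < p ^ s) (hk : k < j) (hjk : 2 * j ≤ p ^ s + k)
    (hd : minPairDist (multipleCode (2 * p ^ s) ((X ^ 2 - C a) ^ j) :
      Set (Fin (2 * p ^ s) → F)) = 2 * j + 2) :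
    ∃ size d, TableRow p m 2 s j k size d := by
  have hp2 := hp.two_le
  by_cases hj1 : j = 1
  · obtain rfl : k = 0 := by omega
    subst hj1
    exact ⟨_, _, .row6 _⟩
  by_cases hj2 : j + 1 = p ^ s
  · obtain rfl : j = p ^ s - 1 := by omega
    obtain rfl : k = p ^ s - 2 := by omega
    exact ⟨_, _, .row8 s⟩
  obtain _ | _ | s := s
  · omega
  · rw [zero_add, pow_one] at *
    exact ⟨_, _, .row7 j k (by omega) (by omega) hjk hk⟩
  exfalso
  simp only [add_assoc, Nat.reduceAdd] at *
  have hP : p ≤ p ^ (s + 1) := Nat.le_self_pow (by omega) p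
  have hpow : p ^ (s + 2) = p * p ^ (s + 1) := pow_succ' _ _
  -- With P = p^(s+1), the first case gives tP + 1 ≤ j ≤ t + 1, so j = 1. The last block needs P ≤ i
  -- + 1, but j + 1 < p^(s+2) gives i + 1 < P.
  rcases exists_minPairDist_le (a := a) hp two_pos (by omega : 1 ≤ j) hj with
    ⟨t, ht, htj, hle⟩ | ⟨i, r, rfl, rfl, -, hle⟩
  · rw [hd] at hle
    have h3 : t * 2 ≤ t * p ^ (s + 1) := Nat.mul_le_mul_left t (by omega)
    omega
  · rw [hd] at hle
    have hlt : r * (i + 1) < r * (r + 1) ^ (s + 1) := by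
      refine Nat.mul_lt_mul_of_pos_left ?_ (by omega)
      rw [hpow, add_mul, one_mul] at hj hj2
      omega
    have h5 : (r + 1) * (i + 1) = r * (i + 1) + (i + 1) := by ring
    omega

end BinomialPower

/-! ### Ideals over F + uF: residue and torsion -/

section DualPoly

variable {F : Type*} [Field F] {N : ℕ}

/-- The polynomial `a + u b` over `F + uF`. -/
noncomputable def dualPoly (a b : F[X]) : F[ε][X] :=
  a.map (algebraMap F F[ε]) + C ε * b.map (algebraMap F F[ε])

theorem fst_coeff_dualPoly (a b : F[X]) (k : ℕ) : ((dualPoly a b).coeff k).fst = a.coeff k := by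
  simp [dualPoly, TrivSqZeroExt.algebraMap_eq_inl]

theorem snd_coeff_dualPoly (a b : F[X]) (k : ℕ) : ((dualPoly a b).coeff k).snd = b.coeff k := by
  simp [dualPoly, TrivSqZeroExt.algebraMap_eq_inl]

theorem dualPoly_inj {a b a' b' : F[X]} : dualPoly a b = dualPoly a' b' ↔ a = a' ∧ b = b' := by
  refine ⟨fun h => ⟨?_, ?_⟩, fun h => by rw [h.1, h.2]⟩
  · ext k
    rw [← fst_coeff_dualPoly a b, h, fst_coeff_dualPoly]
  · ext k
    rw [← snd_coeff_dualPoly a b, h, snd_coeff_dualPoly]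

theorem dualPoly_add (a b a' b' : F[X]) :
    dualPoly a b + dualPoly a' b' = dualPoly (a + a') (b + b') := by
  simp only [dualPoly, Polynomial.map_add]
  ring

theorem dualPoly_sub (a b a' b' : F[X]) :
    dualPoly a b - dualPoly a' b' = dualPoly (a - a') (b - b') := by
  simp only [dualPoly, Polynomial.map_sub]
  ring

theorem dualPoly_mul (a b a' b' : F[X]) :
    dualPoly a b * dualPoly a' b' = dualPoly (a * a') (a * b' + b * a') := by
  have h : (C ε : F[ε][X]) * C ε = 0 := by rw [← C_mul, DualNumber.eps_mul_eps, C_0]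
  simp only [dualPoly, Polynomial.map_add, Polynomial.map_mul]
  linear_combination (b.map (algebraMap F F[ε]) * b'.map (algebraMap F F[ε])) * h

theorem exists_eq_dualPoly (g : F[ε][X]) : ∃ a b, g = dualPoly a b := by
  -- The second projection is only additive, so its polynomial is assembled coefficientwise.
  refine ⟨g.map (TrivSqZeroExt.fstHom F F F).toRingHom,
    ⟨.ofCoeff (g.toFinsupp.coeff.mapRange TrivSqZeroExt.snd rfl)⟩, ?_⟩
  ext k
  · rw [fst_coeff_dualPoly, coeff_map]; rfl
  · rw [snd_coeff_dualPoly]; rfl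

theorem wordPoly_eq_dualPoly (c : Fin N → F[ε]) :
    wordPoly c = dualPoly (wordPoly fun i => (c i).fst) (wordPoly fun i => (c i).snd) := by
  ext k
  · rw [fst_coeff_dualPoly, coeff_wordPoly, coeff_wordPoly]
    split_ifs <;> rfl
  · rw [snd_coeff_dualPoly, coeff_wordPoly, coeff_wordPoly]
    split_ifs <;> rfl

theorem X_pow_sub_C_eq_dualPoly (N : ℕ) (α β : F) :
    X ^ N - C (algebraMap F F[ε] α + ε * algebraMap F F[ε] β) =
      dualPoly (X ^ N - C α) (-C β) := by
  simp only [dualPoly, Polynomial.map_sub, Polynomial.map_pow, map_X, map_C, Polynomial.map_neg,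
    C_add, C_mul]
  ring

/-- The polynomials `h` with `u h ∈ I`. -/
def torsionIdeal (I : Ideal F[ε][X]) : Ideal F[X] where
  carrier := {h | dualPoly 0 h ∈ I}
  zero_mem' := by simp [dualPoly]
  add_mem' := fun {a b} ha hb => by
    have := I.add_mem ha hb
    rwa [dualPoly_add, add_zero] at this
  smul_mem' := fun r a ha => by
    have := I.mul_mem_left (dualPoly r 0) ha
    rwa [dualPoly_mul, mul_zero, zero_mul, add_zero] at this

/-- The reductions modulo `u` of the elements of `I`. -/
def residueIdeal (I : Ideal F[ε][X]) : Ideal F[X] where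
  carrier := {h | ∃ g, dualPoly h g ∈ I}
  zero_mem' := ⟨0, by simp [dualPoly]⟩
  add_mem' := by
    rintro a b ⟨g, ha⟩ ⟨g', hb⟩
    exact ⟨_, by rw [← dualPoly_add]; exact I.add_mem ha hb⟩
  smul_mem' := by
    rintro r a ⟨g, ha⟩
    exact ⟨r * g + 0 * a, by rw [smul_eq_mul, ← dualPoly_mul]; exact I.mul_mem_left _ ha⟩

variable {I : Ideal F[ε][X]}

theorem mem_torsionIdeal {h : F[X]} : h ∈ torsionIdeal I ↔ dualPoly 0 h ∈ I := Iff.rfl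

theorem mem_torsionIdeal_of_dualPoly_mem {h g : F[X]} (hI : dualPoly h g ∈ I) :
    h ∈ torsionIdeal I := by
  have := I.mul_mem_left (dualPoly 0 1) hI
  rwa [dualPoly_mul, zero_mul, zero_mul, one_mul, zero_add] at this

theorem residueIdeal_le_torsionIdeal : residueIdeal I ≤ torsionIdeal I :=
  fun _ ⟨_, hg⟩ => mem_torsionIdeal_of_dualPoly_mem hg

variable {D : Submodule F[ε] (Fin N → F[ε])} {g₁ g₂ : F[X]}

theorem fst_mem_multipleCode (hD : ∀ c, c ∈ D ↔ wordPoly c ∈ I)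
    (h₁ : residueIdeal I = Ideal.span {g₁}) {c : Fin N → F[ε]} (hc : c ∈ D) :
    (fun i => (c i).fst) ∈ multipleCode N g₁ := by
  rw [mem_multipleCode, ← Ideal.mem_span_singleton, ← h₁]
  rw [hD, wordPoly_eq_dualPoly] at hc
  exact ⟨_, hc⟩

theorem inr_mem_iff (hD : ∀ c, c ∈ D ↔ wordPoly c ∈ I)
    (h₂ : torsionIdeal I = Ideal.span {g₂}) {c : Fin N → F[ε]} (hc : ∀ i, (c i).fst = 0) :
    c ∈ D ↔ (fun i => (c i).snd) ∈ multipleCode N g₂ := by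
  rw [mem_multipleCode, ← Ideal.mem_span_singleton, ← h₂, mem_torsionIdeal, hD,
    wordPoly_eq_dualPoly]
  have : (fun i => (c i).fst) = 0 := funext hc
  rw [this, wordPoly_zero]

/-- A lift may have a `u`-part of large degree; since u(X^N - α) lies in `I`, that part can be
reduced modulo X^N - α. -/
theorem exists_mem_of_fst_mem {α β : F} (hN : 0 < N) (hM : dualPoly (X ^ N - C α) (-C β) ∈ I)
    (hD : ∀ c, c ∈ D ↔ wordPoly c ∈ I) (h₁ : residueIdeal I = Ideal.span {g₁}) {a : Fin N → F}
    (ha : a ∈ multipleCode N g₁) : ∃ c ∈ D, ∀ i, (c i).fst = a i := by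
  rw [mem_multipleCode, ← Ideal.mem_span_singleton, ← h₁] at ha
  obtain ⟨g, hg⟩ := ha
  have hmonic := monic_X_pow_sub_C α hN.ne'
  have hr : (g %ₘ (X ^ N - C α)).degree < N := by
    rw [← degree_X_pow_sub_C hN α]
    exact degree_modByMonic_lt _ hmonic
  refine ⟨fun i => TrivSqZeroExt.inl (a i) + TrivSqZeroExt.inr ((g %ₘ (X ^ N - C α)).coeff i),
    ?_, fun i => by simp⟩
  rw [hD, wordPoly_eq_dualPoly]
  have h1 : (fun i => (TrivSqZeroExt.inl (a i) +
      TrivSqZeroExt.inr ((g %ₘ (X ^ N - C α)).coeff i) : F[ε]).fst) = a := by ext; simp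
  have h2 : (fun i : Fin N => (TrivSqZeroExt.inl (a i) +
      TrivSqZeroExt.inr ((g %ₘ (X ^ N - C α)).coeff i) : F[ε]).snd) =
        polyWord N (g %ₘ (X ^ N - C α)) := by ext; simp [polyWord]
  rw [h1, h2, wordPoly_polyWord hr]
  have h3 := (torsionIdeal I).mul_mem_left (g /ₘ (X ^ N - C α))
    (mem_torsionIdeal_of_dualPoly_mem hM)
  have h4 := I.sub_mem hg h3
  rw [dualPoly_sub, sub_zero] at h4
  rwa [modByMonic_eq_sub_mul_div, mul_comm (X ^ N - C α)]

/-- Reduction modulo `u` maps `D` onto the residue code, with kernel `u` times the torsion code. -/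
theorem card_eq_mul {α β : F} (hN : 0 < N) (hM : dualPoly (X ^ N - C α) (-C β) ∈ I)
    (hD : ∀ c, c ∈ D ↔ wordPoly c ∈ I) (h₁ : residueIdeal I = Ideal.span {g₁})
    (h₂ : torsionIdeal I = Ideal.span {g₂}) :
    Nat.card D = Nat.card (multipleCode N g₂) * Nat.card (multipleCode N g₁) := by
  let φ : D →+ multipleCode N g₁ :=
    { toFun := fun c => ⟨fun i => (c.1 i).fst, fst_mem_multipleCode hD h₁ c.2⟩
      map_zero' := rfl
      map_add' := fun _ _ => rfl }
  have hφ : Function.Surjective φ := by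
    rintro ⟨a, ha⟩
    obtain ⟨c, hc, h⟩ := exists_mem_of_fst_mem hN hM hD h₁ ha
    exact ⟨⟨c, hc⟩, Subtype.ext (funext h)⟩
  rw [← AddSubgroup.card_mul_index φ.ker, AddSubgroup.index_ker,
    AddMonoidHom.range_eq_top.2 hφ]
  congr 1
  · have hker : ∀ c : φ.ker, ∀ i, (c.1.1 i).fst = 0 := fun c i =>
      congrFun (congrArg Subtype.val (AddMonoidHom.mem_ker.1 c.2)) i
    refine Nat.card_congr (Equiv.ofBijective (fun c => (⟨fun i => (c.1.1 i).snd,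
      (inr_mem_iff hD h₂ (hker c)).1 c.1.2⟩ : multipleCode N g₂)) ⟨?_, ?_⟩)
    · intro c c' h
      refine Subtype.ext (Subtype.ext (funext fun i => ?_))
      refine TrivSqZeroExt.ext ?_ (congrFun (congrArg Subtype.val h) i)
      rw [hker, hker]
    · rintro ⟨a, ha⟩
      have hmem : (fun i => TrivSqZeroExt.inr (a i) : Fin N → F[ε]) ∈ D :=
        (inr_mem_iff hD h₂ fun i => rfl).2 ha
      exact ⟨⟨⟨_, hmem⟩, rfl⟩, rfl⟩
  · exact Nat.card_congr AddSubgroup.topEquiv.toEquiv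

/-- Multiplying by `u` embeds the torsion code with the same weights. Conversely, a codeword is
either `u` times a torsion word or has a nonzero reduction, again a torsion word, of no larger
weight. -/
theorem minPairDist_eq_multipleCode (hD : ∀ c, c ∈ D ↔ wordPoly c ∈ I)
    (h₂ : torsionIdeal I = Ideal.span {g₂}) (hne : multipleCode N g₂ ≠ ⊥) :
    minPairDist (D : Set (Fin N → F[ε])) = minPairDist (multipleCode N g₂ : Set (Fin N → F)) := by
  obtain ⟨a, ha, ha0, haw⟩ := exists_pairWeight_eq_minPairDist _ hne
  have hmem : (fun i => TrivSqZeroExt.inr (a i) : Fin N → F[ε]) ∈ D :=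
    (inr_mem_iff hD h₂ fun i => rfl).2 ha
  have hmem0 : (fun i => TrivSqZeroExt.inr (a i) : Fin N → F[ε]) ≠ 0 := fun h =>
    ha0 (funext fun i => congrArg TrivSqZeroExt.snd (congrFun h i))
  refine le_antisymm ?_ ?_
  · rw [← haw]
    refine (minPairDist_le D hmem hmem0).trans (pairWeight_mono fun i hi => ?_)
    rw [hi, TrivSqZeroExt.inr_zero]
  · obtain ⟨c, hc, hc0, hcw⟩ := exists_pairWeight_eq_minPairDist D
      ((Submodule.ne_bot_iff _).2 ⟨_, hmem, hmem0⟩)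
    rw [← hcw]
    by_cases h : ∀ i, (c i).fst = 0
    · refine (minPairDist_le _ ((inr_mem_iff hD h₂ h).1 hc) ?_).trans
        (pairWeight_mono fun i hi => by rw [hi]; rfl)
      exact fun h0 => hc0 (funext fun i => TrivSqZeroExt.ext (h i) (congrFun h0 i))
    · have h1 : (fun i => (c i).fst) ∈ multipleCode N g₂ := by
        rw [mem_multipleCode, ← Ideal.mem_span_singleton, ← h₂]
        rw [hD, wordPoly_eq_dualPoly] at hc
        exact mem_torsionIdeal_of_dualPoly_mem hc
      refine (minPairDist_le _ h1 ?_).trans (pairWeight_mono fun i hi => by rw [hi]; rfl)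
      exact fun h0 => h (congrFun h0)

theorem eq_top_of_residueIdeal_eq_top (hD : ∀ c, c ∈ D ↔ wordPoly c ∈ I)
    (h₁ : residueIdeal I = ⊤) (h₂ : torsionIdeal I = ⊤) : D = ⊤ := by
  rw [eq_top_iff]
  intro c _
  rw [hD, wordPoly_eq_dualPoly]
  obtain ⟨g, hg⟩ : (wordPoly fun i => (c i).fst) ∈ residueIdeal I := by rw [h₁]; trivial
  have h : (wordPoly fun i => (c i).snd) - g ∈ torsionIdeal I := by rw [h₂]; trivial
  have := I.add_mem hg h
  rwa [dualPoly_add, add_zero, add_sub_cancel] at this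

theorem eq_span_pair {a g : F[X]} {M : F[ε][X]} (hM : M ∈ I) (ha : dualPoly a g ∈ I)
    (h₁ : residueIdeal I = Ideal.span {a}) (h₂ : torsionIdeal I = Ideal.span {a}) :
    I = Ideal.span {dualPoly a g, M} := by
  refine le_antisymm (fun x hx => ?_) (Ideal.span_le.2 ?_)
  · obtain ⟨y, z, rfl⟩ := exists_eq_dualPoly x
    obtain ⟨q, rfl⟩ : a ∣ y := by
      rw [← Ideal.mem_span_singleton, ← h₁]
      exact ⟨z, hx⟩
    have hG : dualPoly a g ∈ Ideal.span {dualPoly a g, M} := Ideal.subset_span (by simp)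
    have h := I.sub_mem hx (I.mul_mem_left (dualPoly q 0) ha)
    rw [dualPoly_mul, dualPoly_sub, zero_mul, add_zero, mul_comm q, sub_self,
      ← mem_torsionIdeal, h₂, Ideal.mem_span_singleton] at h
    obtain ⟨r, hr⟩ := h
    have : dualPoly (a * q) z = dualPoly q r * dualPoly a g := by
      rw [dualPoly_mul, dualPoly_inj]
      exact ⟨mul_comm _ _, by linear_combination hr⟩
    rw [this]
    exact Ideal.mul_mem_left _ _ hG
  · rintro x (rfl | rfl)
    exacts [ha, hM]

theorem residueIdeal_span_pair {f g : F[X]} {i e : ℕ} (hie : i ≤ e) :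
    residueIdeal (Ideal.span {dualPoly (f ^ i) g, dualPoly (f ^ e) 0}) = Ideal.span {f ^ i} := by
  refine le_antisymm ?_ (Ideal.span_le.2 ?_)
  · rintro h ⟨h', hh⟩
    obtain ⟨x, y, hxy⟩ := Ideal.mem_span_pair.1 hh
    obtain ⟨x, x', rfl⟩ := exists_eq_dualPoly x
    obtain ⟨y, y', rfl⟩ := exists_eq_dualPoly y
    rw [dualPoly_mul, dualPoly_mul, dualPoly_add, dualPoly_inj] at hxy
    rw [Ideal.mem_span_singleton, ← hxy.1]
    exact dvd_add (dvd_mul_left _ _) ((pow_dvd_pow f hie).mul_left _)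
  · rintro _ rfl
    exact ⟨g, Ideal.subset_span (by simp)⟩

/-- A combination with zero residue has first coefficient `-y * f ^ (e - i)` modulo `u`, so the only
new torsion comes from `f ^ (e - i) * g`, which `hg` controls. -/
theorem torsionIdeal_span_pair {f g : F[X]} (hf : f ≠ 0) {i e : ℕ} (hie : i ≤ e)
    (hg : f ^ i ∣ f ^ (e - i) * g) :
    torsionIdeal (Ideal.span {dualPoly (f ^ i) g, dualPoly (f ^ e) 0}) = Ideal.span {f ^ i} := by
  refine le_antisymm ?_ (Ideal.span_le.2 ?_)
  · intro h hh
    obtain ⟨x, y, hxy⟩ := Ideal.mem_span_pair.1 (mem_torsionIdeal.1 hh)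
    obtain ⟨x, x', rfl⟩ := exists_eq_dualPoly x
    obtain ⟨y, y', rfl⟩ := exists_eq_dualPoly y
    rw [dualPoly_mul, dualPoly_mul, dualPoly_add, dualPoly_inj] at hxy
    obtain ⟨h1, h2⟩ := hxy
    have hpow : f ^ e = f ^ (e - i) * f ^ i := by rw [← pow_add, Nat.sub_add_cancel hie]
    have hx : x = -(y * f ^ (e - i)) := by
      refine mul_right_cancel₀ (pow_ne_zero i hf) ?_
      linear_combination h1 - y * hpow
    rw [Ideal.mem_span_singleton, ← h2, hx, mul_zero, zero_add]
    refine dvd_add (dvd_add ?_ (dvd_mul_left _ _)) ((pow_dvd_pow f hie).mul_left _)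
    rw [neg_mul, dvd_neg, mul_assoc]
    exact hg.mul_left _
  · rintro _ rfl
    exact mem_torsionIdeal_of_dualPoly_mem (g := g) (Ideal.subset_span (by simp))

theorem exists_ideal_eq_span_pow {f : F[X]} (hf : Irreducible f) {e : ℕ} {J : Ideal F[X]}
    (hJ : f ^ e ∈ J) : ∃ i ≤ e, J = Ideal.span {f ^ i} := by
  obtain ⟨g, rfl⟩ := (IsPrincipalIdealRing.principal J).principal
  obtain ⟨i, hi, h⟩ := (dvd_prime_pow hf.prime e).1 (Ideal.mem_span_singleton.1 hJ)
  exact ⟨i, hi, Ideal.span_singleton_eq_span_singleton.2 h⟩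

end DualPoly

/-! ### Classification of the MDS codes -/

section Classification

variable {F : Type*} [Field F] {N : ℕ}

instance [Finite F] : Finite F[ε] := inferInstanceAs (Finite (F × F))

theorem card_dualNumber (F : Type*) : Nat.card F[ε] = Nat.card F ^ 2 := by
  rw [sq]
  exact Nat.card_prod F F

theorem isUnit_algebraMap_add_eps_mul {α : F} (hα : α ≠ 0) (β : F) :
    IsUnit (algebraMap F F[ε] α + ε * algebraMap F F[ε] β) := by
  rw [TrivSqZeroExt.isUnit_iff_isUnit_fst]
  simpa [TrivSqZeroExt.algebraMap_eq_inl] using hα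

theorem isUnit_mk_of_isCoprime {g b : F[X]} (h : IsCoprime b g) : IsUnit (AdjoinRoot.mk g b) := by
  obtain ⟨x, y, hxy⟩ := h
  refine IsUnit.of_mul_eq_one_right (AdjoinRoot.mk g x) ?_
  rw [← map_mul, ← map_one (AdjoinRoot.mk g), AdjoinRoot.mk_eq_mk]
  exact ⟨-y, by linear_combination hxy⟩

variable {I : Ideal F[ε][X]} {D : Submodule F[ε] (Fin N → F[ε])} {f : F[X]} {e : ℕ} {α β : F}

theorem card_eq_pow_mul_pow (hN : 0 < N) (hM : dualPoly (X ^ N - C α) (-C β) ∈ I)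
    (hD : ∀ c, c ∈ D ↔ wordPoly c ∈ I) {g₁ g₂ : F[X]} (h₁ : residueIdeal I = Ideal.span {g₁})
    (h₂ : torsionIdeal I = Ideal.span {g₂}) (hm₁ : g₁.Monic) (hm₂ : g₂.Monic)
    (hd₁ : g₁.natDegree ≤ N) (hd₂ : g₂.natDegree ≤ N) :
    Nat.card D = Nat.card F ^ ((N - g₂.natDegree) + (N - g₁.natDegree)) := by
  rw [card_eq_mul hN hM hD h₁ h₂, card_multipleCode hm₁ hd₁, card_multipleCode hm₂ hd₂, pow_add]

/-- Eliminating f^e between the generator and the modulus puts f^(e-j)·g + β into the torsion ideal.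
As 1 ≤ j < e, `f` divides the constant β, which must vanish. -/
theorem eq_zero_of_residueIdeal_eq_torsionIdeal (hf : ¬IsUnit f) (hfe : f ^ e = X ^ N - C α)
    (hM : dualPoly (X ^ N - C α) (-C β) ∈ I) {j : ℕ} (hj1 : 1 ≤ j) (hje : j < e) {g : F[X]}
    (hg : dualPoly (f ^ j) g ∈ I) (h₂ : torsionIdeal I = Ideal.span {f ^ j}) :
    β = 0 ∧ f ^ j ∣ f ^ (e - j) * g := by
  have h := I.sub_mem (I.mul_mem_left (dualPoly (f ^ (e - j)) 0) hg) hM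
  rw [dualPoly_mul, dualPoly_sub, ← hfe, ← pow_add, Nat.sub_add_cancel hje.le, sub_self,
    zero_mul, add_zero, sub_neg_eq_add, ← mem_torsionIdeal, h₂, Ideal.mem_span_singleton] at h
  have hβ : β = 0 := by
    by_contra hβ
    have h1 : f ∣ f ^ (e - j) * g + C β := (dvd_pow_self f (by omega)).trans h
    have h2 : f ∣ C β :=
      (dvd_add_right ((dvd_pow_self f (by omega : e - j ≠ 0)).mul_right g)).1 h1
    exact hf (isUnit_of_dvd_unit h2 (isUnit_C.2 (isUnit_iff_ne_zero.2 hβ)))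
  rw [hβ, C_0, add_zero] at h
  exact ⟨hβ, h⟩

/-- Up to multiples of `f ^ j`, the second component of a generator is zero or `f ^ k` times a
unit. -/
theorem exists_pow_mul_isZeroOrUnit (hf : Irreducible f) (hfe : f ^ e = X ^ N - C α)
    {j : ℕ} (hj1 : 1 ≤ j) (hje : j < e) {g : F[X]} (hg : dualPoly (f ^ j) g ∈ I)
    (h₂ : torsionIdeal I = Ideal.span {f ^ j}) (hgj : f ^ j ∣ f ^ (e - j) * g) :
    ∃ k b, k < j ∧ 2 * j ≤ e + k ∧ IsZeroOrUnit N α b ∧ dualPoly (f ^ j) (f ^ k * b) ∈ I := by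
  by_cases hdvd : f ^ j ∣ g
  -- With `b = 0` the exponent is immaterial; `j - 1` meets both inequalities because `j < e`.
  · refine ⟨j - 1, 0, by omega, by omega, Or.inl (map_zero _), ?_⟩
    have h : g ∈ torsionIdeal I := by rwa [h₂, Ideal.mem_span_singleton]
    have := I.sub_mem hg h
    rwa [dualPoly_sub, sub_zero, sub_self, ← mul_zero (f ^ (j - 1))] at this
  · have hg0 : g ≠ 0 := by rintro rfl; exact hdvd (dvd_zero _)
    have hfin : FiniteMultiplicity f g := FiniteMultiplicity.of_prime_left hf.prime hg0
    obtain ⟨b, hgb, hb⟩ := hfin.exists_eq_pow_mul_and_not_dvd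
    have hk : multiplicity f g < j := by
      by_contra! hle
      exact hdvd ((pow_dvd_pow f hle).trans (pow_multiplicity_dvd f g))
    refine ⟨multiplicity f g, b, hk, ?_, Or.inr ?_, ?_⟩
    · rw [hgb, ← mul_assoc, ← pow_add] at hgj
      have h1 := hf.prime.pow_dvd_of_dvd_mul_right j hb hgj
      have h2 := (pow_dvd_pow_iff hf.ne_zero hf.not_isUnit).1 h1
      omega
    · rw [← hfe]
      exact isUnit_mk_of_isCoprime (IsCoprime.pow_right (hf.coprime_iff_not_dvd.2 hb).symm)
    · rwa [← hgb]

variable {p m n s : ℕ} {α₀ : F}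

theorem mem_tableCode_iff (j k : ℕ) (b : F[X]) (c : Fin (n * p ^ s) → F[ε]) :
    c ∈ tableCode p n s α₀ j k b ↔ wordPoly c ∈ Ideal.span
      {dualPoly ((X ^ n - C α₀) ^ j) ((X ^ n - C α₀) ^ k * b),
        dualPoly (X ^ (n * p ^ s) - C (α₀ ^ p ^ s)) (-C 0)} := by
  rw [tableCode, mem_polyCode, ← X_pow_sub_C_eq_dualPoly, map_zero, mul_zero, add_zero]
  rfl

variable [CharP F p]

section TableCode

variable {j k : ℕ} (b : F[X])

theorem ideals_tableCode (hp : p.Prime) (hn : 0 < n) (hj : j < p ^ s) (hk : 2 * j ≤ p ^ s + k) :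
    residueIdeal (Ideal.span {dualPoly ((X ^ n - C α₀) ^ j) ((X ^ n - C α₀) ^ k * b),
        dualPoly (X ^ (n * p ^ s) - C (α₀ ^ p ^ s)) (-C 0)}) =
      Ideal.span {(X ^ n - C α₀) ^ j} ∧
    torsionIdeal (Ideal.span {dualPoly ((X ^ n - C α₀) ^ j) ((X ^ n - C α₀) ^ k * b),
        dualPoly (X ^ (n * p ^ s) - C (α₀ ^ p ^ s)) (-C 0)}) =
      Ideal.span {(X ^ n - C α₀) ^ j} := by
  rw [← X_pow_sub_C_pow_char_pow p hp, C_0, neg_zero]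
  refine ⟨residueIdeal_span_pair hj.le,
    torsionIdeal_span_pair (monic_X_pow_sub_C α₀ hn.ne').ne_zero hj.le ?_⟩
  rw [← mul_assoc, ← pow_add]
  exact (pow_dvd_pow _ (by omega)).mul_right _

theorem card_tableCode (hp : p.Prime) (hn : 0 < n) (hj : j < p ^ s) (hk : 2 * j ≤ p ^ s + k) :
    Nat.card (tableCode p n s α₀ j k b) = Nat.card F ^ (2 * (n * p ^ s - n * j)) := by
  obtain ⟨h₁, h₂⟩ := ideals_tableCode (α₀ := α₀) b hp hn hj hk
  have hm := monic_X_pow_sub_C_pow hn α₀ j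
  have hd := natDegree_X_pow_sub_C_pow n α₀ j
  have hle : ((X ^ n - C α₀) ^ j).natDegree ≤ n * p ^ s := hd ▸ Nat.mul_le_mul_left n hj.le
  rw [card_eq_pow_mul_pow (α := α₀ ^ p ^ s) (β := 0) (Nat.mul_pos hn (pow_pos hp.pos s))
    (Ideal.subset_span (by simp))
    (mem_tableCode_iff j k b) h₁ h₂ hm hm hle hle, hd, two_mul]

theorem minPairDist_tableCode (hp : p.Prime) (hn : 0 < n) (hj : j < p ^ s)
    (hk : 2 * j ≤ p ^ s + k) :
    minPairDist (tableCode p n s α₀ j k b : Set (Fin (n * p ^ s) → F[ε])) =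
      minPairDist (multipleCode (n * p ^ s) ((X ^ n - C α₀) ^ j) :
        Set (Fin (n * p ^ s) → F)) :=
  minPairDist_eq_multipleCode (mem_tableCode_iff j k b) (ideals_tableCode b hp hn hj hk).2
    (multipleCode_ne_bot dvd_rfl (monic_X_pow_sub_C_pow hn α₀ j)
      (by rw [natDegree_X_pow_sub_C_pow]; exact Nat.mul_lt_mul_of_pos_left hj hn))

end TableCode

theorem TableRow.tableCode_isMDS [Finite F] (hp : p.Prime) (hs : 1 ≤ s) (hn : 0 < n)
    (hα₀ : α₀ ≠ 0) {j k size d : ℕ} (h : TableRow p m n s j k size d) (b : F[X]) :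
    IsConstacyclic (algebraMap F F[ε] (α₀ ^ p ^ s) + ε * algebraMap F F[ε] 0)
      (tableCode p n s α₀ j k b) ∧ tableCode p n s α₀ j k b ≠ ⊥ ∧ tableCode p n s α₀ j k b ≠ ⊤ ∧
      IsMDS (tableCode p n s α₀ j k b : Set (Fin (n * p ^ s) → F[ε])) := by
  obtain ⟨hj1, hjs, -, hk, -, -⟩ := h.bounds hp hs
  have hcard := card_tableCode (α₀ := α₀) b hp hn hjs hk
  have hF : 1 < Nat.card F := Finite.one_lt_card
  have hlt : n * j < n * p ^ s := Nat.mul_lt_mul_of_pos_left hjs hn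
  have hnj : 0 < n * j := Nat.mul_pos hn hj1
  refine ⟨?_, ?_, ?_, ?_⟩
  · rw [isConstacyclic_iff (isUnit_algebraMap_add_eps_mul (pow_ne_zero _ hα₀) 0)]
    intro c hc
    rw [mem_tableCode_iff, ← X_pow_sub_C_eq_dualPoly] at hc ⊢
    exact constaShift_mem_of_ideal (by omega) (Ideal.subset_span (by simp)) hc
  · intro hbot
    rw [hbot, Nat.card_unique] at hcard
    have := Nat.pow_eq_one.1 hcard.symm
    omega
  · intro htop
    rw [htop, Nat.card_congr Submodule.topEquiv.toEquiv, Nat.card_fun, Nat.card_fin,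
      card_dualNumber, ← pow_mul] at hcard
    have := Nat.pow_right_injective hF hcard
    omega
  · rw [IsMDS, minPairDist_tableCode b hp hn hjs hk, h.minPairDist_eq hp hs hn hα₀,
      card_dualNumber, ← pow_mul]
    refine hcard.trans ?_
    congr 2
    omega

theorem exists_tableRow_of_isMDS [Finite F] (hp : p.Prime) (hs : 1 ≤ s) (hα₀ : α₀ ≠ 0)
    (hirr : Irreducible (X ^ n - C α₀)) {D : Submodule F[ε] (Fin (n * p ^ s) → F[ε])}
    (hcyc : IsConstacyclic (algebraMap F F[ε] (α₀ ^ p ^ s) + ε * algebraMap F F[ε] β) D)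
    (hbot : D ≠ ⊥) (htop : D ≠ ⊤) (hmds : IsMDS (D : Set (Fin (n * p ^ s) → F[ε]))) :
    β = 0 ∧ (n = 1 ∨ n = 2) ∧ ∃ (j k size d : ℕ) (b : F[X]), TableRow p m n s j k size d ∧
      IsZeroOrUnit (n * p ^ s) (α₀ ^ p ^ s) b ∧ D = tableCode p n s α₀ j k b := by
  have hn : 0 < n := by
    refine Nat.pos_of_ne_zero ?_
    rintro rfl
    have h1 : (X ^ 0 - C α₀ : F[X]) = C (1 - α₀) := by simp
    rw [h1] at hirr
    exact not_irreducible_C _ hirr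
  have hN : 0 < n * p ^ s := Nat.mul_pos hn (pow_pos hp.pos s)
  have hF : 1 < Nat.card F := Finite.one_lt_card
  have hfe := X_pow_sub_C_pow_char_pow p hp n s α₀
  obtain ⟨I, hM, hD⟩ := exists_ideal_of_constaShift_mem hN D
    ((isConstacyclic_iff (isUnit_algebraMap_add_eps_mul (pow_ne_zero _ hα₀) β) D).1 hcyc)
  rw [X_pow_sub_C_eq_dualPoly] at hM
  obtain ⟨i, hi, h₁⟩ := exists_ideal_eq_span_pow hirr (e := p ^ s) (J := residueIdeal I)
    (by rw [hfe]; exact ⟨_, hM⟩)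
  obtain ⟨j, hj, h₂⟩ := exists_ideal_eq_span_pow hirr (e := p ^ s) (J := torsionIdeal I)
    (by rw [hfe]; exact mem_torsionIdeal_of_dualPoly_mem hM)
  have hji : j ≤ i := by
    have := residueIdeal_le_torsionIdeal (I := I)
    rw [h₁, h₂, Ideal.span_singleton_le_span_singleton] at this
    exact (pow_dvd_pow_iff hirr.ne_zero hirr.not_isUnit).1 this
  have hnj : n * j ≤ n * i := Nat.mul_le_mul_left n hji
  have hni : n * i ≤ n * p ^ s := Nat.mul_le_mul_left n hi
  have hcard := card_eq_pow_mul_pow hN hM hD h₁ h₂ (monic_X_pow_sub_C_pow hn α₀ i)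
    (monic_X_pow_sub_C_pow hn α₀ j) (by rwa [natDegree_X_pow_sub_C_pow])
    (by rw [natDegree_X_pow_sub_C_pow]; omega)
  rw [natDegree_X_pow_sub_C_pow, natDegree_X_pow_sub_C_pow] at hcard
  -- If `j = p ^ s`, then `i = p ^ s` too, and the size formula leaves only the zero code.
  have hjs : j < p ^ s := by
    refine hj.lt_of_ne ?_
    rintro rfl
    obtain rfl : i = p ^ s := by omega
    rw [Nat.sub_self, pow_zero, Nat.card_eq_one_iff_unique] at hcard
    have := hcard.1
    exact hbot Submodule.eq_bot_of_subsingleton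
  have hnjs : n * j < n * p ^ s := Nat.mul_lt_mul_of_pos_left hjs hn
  have hdist := minPairDist_eq_multipleCode hD h₂ (multipleCode_ne_bot dvd_rfl
    (monic_X_pow_sub_C_pow hn α₀ j) (by rwa [natDegree_X_pow_sub_C_pow]))
  have hle := minPairDist_multipleCode_le (a := α₀) hn hjs
  have hle' := minPairDist_multipleCode_le_length (N := n * p ^ s) dvd_rfl
    (monic_X_pow_sub_C_pow hn α₀ j) (by rwa [natDegree_X_pow_sub_C_pow])
  have hmds' : Nat.card D = _ := hmds
  rw [hcard, card_dualNumber, ← pow_mul, hdist] at hmds'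
  have hexp := Nat.pow_right_injective hF hmds'
  -- The exponents give n(i+j) = 2(d-2), with no truncation as d ≤ N; together with d ≤ nj+2 and nj
  -- ≤ ni this forces equality throughout.
  have hd : minPairDist (multipleCode (n * p ^ s) ((X ^ n - C α₀) ^ j) :
      Set (Fin (n * p ^ s) → F)) = n * j + 2 := by omega
  obtain rfl : i = j := by
    have : n * i = n * j := by omega
    exact Nat.eq_of_mul_eq_mul_left hn this
  have hj1 : 1 ≤ i := by
    refine Nat.pos_of_ne_zero ?_
    rintro rfl
    rw [pow_zero, Ideal.span_singleton_one] at h₁ h₂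
    exact htop (eq_top_of_residueIdeal_eq_top hD h₁ h₂)
  obtain ⟨g, hg⟩ : (X ^ n - C α₀) ^ i ∈ residueIdeal I := by
    rw [h₁]; exact Ideal.mem_span_singleton_self _
  obtain ⟨rfl, hgj⟩ :=
    eq_zero_of_residueIdeal_eq_torsionIdeal hirr.not_isUnit hfe hM hj1 hjs hg h₂
  obtain ⟨k, b, hk, hjk, hb, hG⟩ := exists_pow_mul_isZeroOrUnit hirr hfe hj1 hjs hg h₂ hgj
  have hn12 := length_le_two_of_minPairDist_eq hn hj1 hjs hd
  have hDt : D = tableCode p n s α₀ i k b := by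
    ext c
    rw [hD, mem_tableCode_iff, ← eq_span_pair hM hG h₁ h₂]
  refine ⟨rfl, hn12, ?_⟩
  rcases hn12 with rfl | rfl
  · obtain ⟨size, d, h⟩ := exists_tableRow_one (m := m) hp hs hjs hk hjk hd
    exact ⟨i, k, size, d, b, h, hb, hDt⟩
  · obtain ⟨size, d, h⟩ := exists_tableRow_two (m := m) hp hs hjs hk hjk hd
    exact ⟨i, k, size, d, b, h, hb, hDt⟩

end Classification

end SymbolPair

theorem mainTheorem4 {F : Type*} [Field F] (p m n s : ℕ) (hp : p.Prime) (hm : 1 ≤ m)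
    (hs : 1 ≤ s) (hF : Nat.card F = p ^ m) (α₀ β : F) (hα₀ : α₀ ≠ 0)
    (hirr : Irreducible (X ^ n - C α₀ : F[X])) :
    (∀ D : Submodule F[ε] (Fin (n * p ^ s) → F[ε]),
      (SymbolPair.IsConstacyclic
          (algebraMap F F[ε] (α₀ ^ p ^ s) + ε * algebraMap F F[ε] β) D ∧
        D ≠ ⊥ ∧ D ≠ ⊤ ∧ SymbolPair.IsMDS (D : Set (Fin (n * p ^ s) → F[ε]))) ↔
      (β = 0 ∧ (n = 1 ∨ n = 2) ∧
        ∃ (j k size d : ℕ) (b : F[X]),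
          SymbolPair.TableRow p m n s j k size d ∧
          SymbolPair.IsZeroOrUnit (n * p ^ s) (α₀ ^ p ^ s) b ∧
          D = SymbolPair.tableCode p n s α₀ j k b)) ∧
    (∀ (j k size d : ℕ) (b : F[X]),
      SymbolPair.TableRow p m n s j k size d →
      SymbolPair.IsZeroOrUnit (n * p ^ s) (α₀ ^ p ^ s) b →
      Nat.card (SymbolPair.tableCode p n s α₀ j k b) = size ∧
      SymbolPair.minPairDist
        (SymbolPair.tableCode p n s α₀ j k b : Set (Fin (n * p ^ s) → F[ε])) = d) := by
  have hFin : Finite F := Nat.finite_of_card_ne_zero (by rw [hF]; exact pow_ne_zero m hp.ne_zero)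
  have hpF : Fact p.Prime := ⟨hp⟩
  have hFty : Fintype F := Fintype.ofFinite F
  have hchar : CharP F p := charP_of_card_eq_prime_pow (Nat.card_eq_fintype_card.symm.trans hF)
  have hnpos : n = 1 ∨ n = 2 → 0 < n := by omega
  refine ⟨fun D => ⟨fun ⟨hcyc, hbot, htop, hmds⟩ =>
    SymbolPair.exists_tableRow_of_isMDS hp hs hα₀ hirr hcyc hbot htop hmds, ?_⟩, ?_⟩
  · rintro ⟨rfl, hn, j, k, size, d, b, h, -, rfl⟩
    exact h.tableCode_isMDS hp hs (hnpos hn) hα₀ b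
  · intro j k size d b h _
    have hn : 0 < n := hnpos (by cases h <;> simp)
    obtain ⟨-, hjs, -, hk, rfl, rfl⟩ := h.bounds hp hs
    refine ⟨?_, ?_⟩
    · rw [SymbolPair.card_tableCode b hp hn hjs hk, hF]
    · rw [SymbolPair.minPairDist_tableCode b hp hn hjs hk, h.minPairDist_eq hp hs hn hα₀]
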